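/- **Problem 1.** Let $f:\mathbb R^n\to\mathbb R$ be $C^1$ with gradient $f_\theta$, and let $\theta^l,\theta^u\in[-\infty,\infty]^n$ with $(\theta^l)_i<(\theta^u)_i$ for all $i$. Minimize $f(\theta)$ over $\mathbb D_f=\{\theta\in\mathbb R^n:\theta^l\le\theta\le\theta^u\}$. Write the constraints as $g(\theta)=\begin{bmatrix}\theta-\theta^u\\-\theta+\theta^l\end{bmatrix}\le 0$, with Jacobian $g_\theta=\begin{bmatrix}I\\-I\end{bmatrix}\in\mathbb R^{2n\times n}$, and let $\mathbb I(\theta)=\{i: g_i(\theta)=0\}$. A point $\theta\in\mathbb D_f$ is a KKT point if there is $\pi_I\in\mathbb R^{2n}$ (a KKT multiplier at $\theta$) with $$f_\theta+g_\theta^T\pi_I=0,\qquad (\pi_I)_i\ge 0\ (i\in\mathbb I(\theta)),\qquad (\pi_I)_i=0\ (i\notin\mathbb I(\theta)).$$ For a symmetric positive-definite matrix $K$ and $\theta\in\mathbb D_f$ consider the quadratic program $$\min_u\ \tfrac12 f_\theta^Tu+\tfrac14u^TK^{-1}u\quad\text{subject to}\quad (g_i)_\theta^Tu\le 0\ \ (i\in\mathbb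 I(\theta)),$$ which has a unique solution $u^*$, and its optimal active set $\mathbb I_p(\theta,K)=\{i\in\mathbb I(\theta):(g_i)_\theta^Tu^*=0\}$. With $\tilde h_\theta$ the rows of $g_\theta$ with index in $\mathbb I_p(\theta,K)$, let $\pi_1(\theta,K)\in\mathbb R^{2n}$ be zero off $\mathbb I_p(\theta,K)$ and equal on $\mathbb I_p(\theta,K)$ to $$\pi=-(\tilde h_\theta K\tilde h_\theta^T)^{-1}\tilde h_\theta Kf_\theta .$$ **Theorem 1.** Let $K_\theta$ be a symmetric positive-definite $n\times n$ gain matrix depending continuously on $\theta\in\mathbb D_f$ (for example constant), and let $\theta(\tau)$, $\tau\ge0$, be any solution in $\mathbb D_f$, from an arbitrary feasible start $\theta(0)\in\mathbb D_f$, of $$\frac{d\theta}{d\tau}=-K_\theta\big(f_\theta+g_\theta^T\pi_1(\theta,K_\theta)\big)$$ in the sense of Carathéodory (locally absolutely continuous, satisfying the equation for almost every $\tau\ge 0$). Then: 1. For every $\tau\ge0$, along the trajectory $\tilde h_\theta K_\theta\tilde h_\theta^T$ is invertible and $\pi_1(\theta,K_\theta)\ge0$. 2. If $\tau_k\to\infty$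 and $\theta(\tau_k)\to\hat\theta$, then $\hat\theta$ is a KKT point, and $\pi_1(\theta(\tau_k),K_{\theta(\tau_k)})\to\pi_1(\hat\theta,K')$ for every symmetric positive-definite matrix $K'$. In particular, if $\theta(\tau)\to\hat\theta$ as $\tau\to\infty$, then $\hat\theta$ satisfies the KKT conditions and the multipliers converge to a limit that does not depend on the gain. 3. If $\{\vartheta\in\mathbb D_f: f(\vartheta)\le f(\theta(0))\}$ is bounded, or if merely the trajectory is bounded, then $f_\theta+g_\theta^T\pi_1(\theta,K_\theta)\to0$ along $\theta(\tau)$ as $\tau\to\infty$, KKT points exist, and the distance from $\theta(\tau)$ to the set of KKT points tends to $0$. 4. Let $\hat\theta\in\mathbb D_f$ be a minimizer of $f$ over $\mathbb D_f$ or a KKT point, and put $\hat{\mathbb I}=\mathbb I(\hat\theta)$. For every symmetric positive-definite $K'$, the optimal active set $\hat{\mathbb I}_p=\mathbb I_p(\hat\theta,K')$ equals $\hat{\mathbb I}$, and $\pi_1(\hat\theta,K')$ is a KKT multiplier at $\hat\theta$ that does not depend on $K'$. -/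

import Mathlib

open Filter Topology MeasureTheory
open scoped Matrix

/-- The data of a box-constrained problem: minimize `f θ` subject to `lo ≤ θ ≤ hi`
componentwise.  Bounds are extended reals, `lo i = ⊥` and `hi i = ⊤` meaning that the
corresponding bound is absent. -/
structure BoxProblem (n : ℕ) where
  /-- the objective function -/
  f : (Fin n → ℝ) → ℝ
  /-- the lower bounds -/
  lo : Fin n → EReal
  /-- the upper bounds -/
  hi : Fin n → EReal

namespace BoxProblem

variable {n : ℕ}

/-- The `2 n` constraint functions `θ - hi` (index `inl i`) and `-θ + lo` (index `inr i`).
At a missing bound the value is `⊥`, so that the constraint holds and is never active. -/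
noncomputable def g (P : BoxProblem n) (θ : Fin n → ℝ) : Fin n ⊕ Fin n → EReal
  | Sum.inl i => (θ i : EReal) - P.hi i
  | Sum.inr i => -(θ i : EReal) + P.lo i

/-- The feasible region. -/
def feasibleSet (P : BoxProblem n) : Set (Fin n → ℝ) := {θ | ∀ j, P.g θ j ≤ 0}

/-- The Jacobian of the constraint functions, the identity stacked on minus the identity. -/
def gJac (n : ℕ) : Matrix (Fin n ⊕ Fin n) (Fin n) ℝ := Matrix.fromRows 1 (-1)

/-- The column vector of partial derivatives of the objective. -/
noncomputable def grad (P : BoxProblem n) (θ : Fin n → ℝ) : Fin n → ℝ :=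
  fun i => fderiv ℝ P.f θ (Pi.single i 1)

open Classical in
/-- The index set of the constraints that are active at `θ`. -/
noncomputable def active (P : BoxProblem n) (θ : Fin n → ℝ) : Finset (Fin n ⊕ Fin n) :=
  Finset.univ.filter fun j => P.g θ j = 0

/-- `π` is a vector of KKT multipliers at `θ`: stationarity, nonnegativity on the active set, and
vanishing off the active set. -/
def IsKKTMultiplier (P : BoxProblem n) (θ : Fin n → ℝ) (π : Fin n ⊕ Fin n → ℝ) : Prop :=
  P.grad θ + (gJac n)ᵀ *ᵥ π = 0 ∧ (∀ j ∈ P.active θ, 0 ≤ π j) ∧ ∀ j ∉ P.active θ, π j = 0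

/-- The points of the feasible region that satisfy the KKT conditions. -/
def kktSet (P : BoxProblem n) : Set (Fin n → ℝ) :=
  {θ | θ ∈ P.feasibleSet ∧ ∃ π, P.IsKKTMultiplier θ π}

/-- The objective of the feasibility-preserving quadratic program at `θ` with gain matrix `K`,
`½ J₁ + ½ J₂` with `J₁ = ∇f(θ)ᵀ u` and `J₂ = ½ uᵀ K⁻¹ u`. -/
noncomputable def qpObjective (P : BoxProblem n) (K : Matrix (Fin n) (Fin n) ℝ)
    (θ u : Fin n → ℝ) : ℝ :=
  (1 / 2) * (P.grad θ ⬝ᵥ u) + (1 / 2) * ((1 / 2) * (u ⬝ᵥ (K⁻¹ *ᵥ u)))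

/-- The feasible controls of the quadratic program: no active constraint function increases to
first order in the direction `u`. -/
def qpFeasible (P : BoxProblem n) (θ : Fin n → ℝ) : Set (Fin n → ℝ) :=
  {u | ∀ j ∈ P.active θ, (gJac n *ᵥ u) j ≤ 0}

/-- `u` is an optimal solution of the quadratic program. -/
def IsQPSolution (P : BoxProblem n) (K : Matrix (Fin n) (Fin n) ℝ) (θ u : Fin n → ℝ) : Prop :=
  u ∈ P.qpFeasible θ ∧ IsMinOn (P.qpObjective K θ) (P.qpFeasible θ) u

open Classical in
/-- The optimal active set of the quadratic program: the constraints active at `θ` whose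
linearization is an equality at the optimal solution of the quadratic program (which exists and
is unique for positive definite `K`). -/
noncomputable def qpActive (P : BoxProblem n) (K : Matrix (Fin n) (Fin n) ℝ) (θ : Fin n → ℝ) :
    Finset (Fin n ⊕ Fin n) :=
  (P.active θ).filter fun j => ∃ u, P.IsQPSolution K θ u ∧ (gJac n *ᵥ u) j = 0

/-- The Jacobian of the constraints with index in `S`. -/
def hJac (S : Finset (Fin n ⊕ Fin n)) : Matrix S (Fin n) ℝ :=
  (gJac n).submatrix Subtype.val id

/-- The vector `-(h K hᵀ)⁻¹ h K c`, where `h` is the Jacobian of the constraints in `S`. -/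
noncomputable def multiplierFormula (S : Finset (Fin n ⊕ Fin n)) (K : Matrix (Fin n) (Fin n) ℝ)
    (c : Fin n → ℝ) : S → ℝ :=
  -((hJac S * K * (hJac S)ᵀ)⁻¹ *ᵥ (hJac S *ᵥ (K *ᵥ c)))

/-- The `2 n` multipliers of the dynamics: zero off the optimal active set of the quadratic
program, and given on this set by `-(h K hᵀ)⁻¹ h K ∇f(θ)`. -/
noncomputable def multiplier (P : BoxProblem n) (K : Matrix (Fin n) (Fin n) ℝ)
    (θ : Fin n → ℝ) : Fin n ⊕ Fin n → ℝ :=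
  fun j => if hj : j ∈ P.qpActive K θ then multiplierFormula (P.qpActive K θ) K (P.grad θ) ⟨j, hj⟩
    else 0

/-- The left-hand side of the KKT stationarity condition, with the multipliers of the dynamics. -/
noncomputable def residual (P : BoxProblem n) (K : Matrix (Fin n) (Fin n) ℝ)
    (θ : Fin n → ℝ) : Fin n → ℝ :=
  P.grad θ + (gJac n)ᵀ *ᵥ P.multiplier K θ

/-- `θ` is a solution on `[0, ∞)`, within the feasible region, of
`dθ/dτ = -K(θ) (∇f(θ) + gJacᵀ π₁(θ))`.  The right-hand side is discontinuous where constraints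
become active or inactive, so solutions are those in the sense of Carathéodory: locally absolutely
continuous curves that satisfy the equation at almost every time. -/
structure IsSolution (P : BoxProblem n) (K : (Fin n → ℝ) → Matrix (Fin n) (Fin n) ℝ)
    (θ : ℝ → Fin n → ℝ) : Prop where
  feasible : ∀ τ, 0 ≤ τ → θ τ ∈ P.feasibleSet
  absCont : ∀ T, 0 ≤ T → AbsolutelyContinuousOnInterval θ 0 T
  eqn : ∀ᵐ τ ∂volume.restrict (Set.Ici (0 : ℝ)),
    HasDerivAt θ (-(K (θ τ) *ᵥ P.residual (K (θ τ)) (θ τ))) τ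

end BoxProblem

/-! The velocity `u = -K r`, with `r` the residual, solves the quadratic program. Its feasible
controls form a cone, so optimality gives `(∇f + K⁻¹ u) ⬝ u = 0`, that is `r ⬝ K r = ∇f ⬝ K r`: the
objective decreases along a solution at the rate `r ⬝ K r`. Since the two bounds of a coordinate
differ, at most one of them is active, and the multipliers are the positive and negative parts of `r
- ∇f`. They are therefore nonnegative, and they converge as soon as `r` and `∇f` do.

The difficulty is that `r` is discontinuous in `θ` where the active set changes, so a continuous
invariance argument does not apply. Instead, let `p` be a limit point, fix `c = ∇f(p)`, and consider
the face of points where `-c` lies in the normal cone of the box. Near `p`, the objective drops at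
rate at least `δ > 0` off this face, while the speed is at most `M` (`exists_local_bounds`). A
displacement inside the box that starts on the face lowers the objective by at most a small multiple
of its length (`eventually_sub_le_of_negMemNormalCone`).

If a solution is near `p` but off the face at a late time, look back over a fixed short time span.
Either it was off the face throughout, and the drop contradicts convergence of the objective; or it
left the face at a last time `a`, and by time `τ` the drop `δ (τ - a)` exceeds what a displacement
of length `M (τ - a)` from the face allows. So late visits near `p` lie on the face
(`exists_forall_negMemNormalCone`). Active constraints stay active in the limit, so `p` is a KKT
point; and on the face `r` is bounded by `∇f(θ) - c`, which tends to zero. Compactness then gives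
the claims on bounded trajectories. -/

/-! ### Matrix estimates in the sup norm -/

lemma abs_dotProduct_le_card_mul_norm {n : ℕ} (x y : Fin n → ℝ) :
    |x ⬝ᵥ y| ≤ n * ‖x‖ * ‖y‖ := by
  calc |x ⬝ᵥ y| ≤ ∑ i, |x i * y i| := Finset.abs_sum_le_sum_abs _ _
    _ ≤ ∑ _i : Fin n, ‖x‖ * ‖y‖ := by
        refine Finset.sum_le_sum fun i _ => ?_
        rw [abs_mul]
        exact mul_le_mul (norm_le_pi_norm x i) (norm_le_pi_norm y i) (abs_nonneg _) (norm_nonneg _)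
    _ = n * ‖x‖ * ‖y‖ := by simp [mul_assoc]

lemma norm_mulVec_le_of_forall_abs_le {n : ℕ} {A : Matrix (Fin n) (Fin n) ℝ} {ε : ℝ} (hε : 0 ≤ ε)
    (hA : ∀ i j, |A i j| ≤ ε) (x : Fin n → ℝ) : ‖A *ᵥ x‖ ≤ n * ε * ‖x‖ := by
  refine (pi_norm_le_iff_of_nonneg (by positivity)).2 fun i => ?_
  refine (abs_dotProduct_le_card_mul_norm (A i) x).trans ?_
  gcongr
  exact (pi_norm_le_iff_of_nonneg hε).2 (hA i)

lemma Matrix.PosDef.exists_pos_mul_sq_norm_le {n : ℕ} {A : Matrix (Fin n) (Fin n) ℝ}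
    (hA : A.PosDef) : ∃ m : ℝ, 0 < m ∧ ∀ x, m * ‖x‖ ^ 2 ≤ x ⬝ᵥ (A *ᵥ x) := by
  -- The sphere is empty exactly when `n = 0`.
  rcases (Metric.sphere (0 : Fin n → ℝ) 1).eq_empty_or_nonempty with h | h
  · refine ⟨1, one_pos, fun x => ?_⟩
    have hx : x = 0 := by
      by_contra hx
      have : (‖x‖⁻¹ • x) ∈ Metric.sphere (0 : Fin n → ℝ) 1 := by
        simp [norm_smul, norm_ne_zero_iff.2 hx]
      simp [h] at this
    simp [hx]
  · have hc : Continuous fun x : Fin n → ℝ => x ⬝ᵥ (A *ᵥ x) := by fun_prop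
    obtain ⟨y, hy, hmin⟩ := (isCompact_sphere (0 : Fin n → ℝ) 1).exists_isMinOn h hc.continuousOn
    have hy0 : y ≠ 0 := by
      rintro rfl
      simp at hy
    refine ⟨y ⬝ᵥ (A *ᵥ y), by simpa using hA.dotProduct_mulVec_pos hy0, fun x => ?_⟩
    rcases eq_or_ne x 0 with rfl | hx
    · simp
    have hx' : 0 < ‖x‖ := norm_pos_iff.2 hx
    have hs : (‖x‖⁻¹ • x) ∈ Metric.sphere (0 : Fin n → ℝ) 1 := by
      simp [norm_smul, hx'.ne']
    have := hmin hs
    simp only [Matrix.mulVec_smul, dotProduct_smul, smul_dotProduct, smul_eq_mul,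
      Set.mem_ofPred_eq] at this
    calc y ⬝ᵥ (A *ᵥ y) * ‖x‖ ^ 2 ≤ (‖x‖⁻¹ * (‖x‖⁻¹ * x ⬝ᵥ (A *ᵥ x))) * ‖x‖ ^ 2 := by gcongr
      _ = x ⬝ᵥ (A *ᵥ x) := by field_simp

lemma Matrix.PosDef.dotProduct_mulVec_comm {n : ℕ} {A : Matrix (Fin n) (Fin n) ℝ}
    (hA : A.PosDef) (x y : Fin n → ℝ) : x ⬝ᵥ (A *ᵥ y) = y ⬝ᵥ (A *ᵥ x) := by
  have h : Aᵀ = A := by simpa using hA.isHermitian.eq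
  rw [← Matrix.dotProduct_transpose_mulVec, h, dotProduct_comm]

/-! ### Constraints and active sets of the box -/

namespace BoxProblem

variable {n : ℕ}

@[simp] lemma gJac_mulVec_inl (u : Fin n → ℝ) (i : Fin n) : (gJac n *ᵥ u) (Sum.inl i) = u i := by
  simp [gJac, Matrix.fromRows_mulVec]

@[simp] lemma gJac_mulVec_inr (u : Fin n → ℝ) (i : Fin n) :
    (gJac n *ᵥ u) (Sum.inr i) = -u i := by
  simp [gJac, Matrix.fromRows_mulVec, Matrix.neg_mulVec]

lemma gJac_transpose_mulVec (π : Fin n ⊕ Fin n → ℝ) (i : Fin n) :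
    ((gJac n)ᵀ *ᵥ π) i = π (Sum.inl i) - π (Sum.inr i) := by
  simp [gJac, Matrix.transpose_fromRows, Matrix.fromCols_mulVec, Matrix.neg_mulVec,
    sub_eq_add_neg]

lemma mem_active {P : BoxProblem n} {θ : Fin n → ℝ} {j : Fin n ⊕ Fin n} :
    j ∈ P.active θ ↔ P.g θ j = 0 := by
  simp [active]

lemma g_inl_eq_zero {P : BoxProblem n} {θ : Fin n → ℝ} {i : Fin n} :
    P.g θ (Sum.inl i) = 0 ↔ P.hi i = θ i := by
  simp only [g]
  induction P.hi i with
  | bot => simp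
  | top => simp
  | coe x => norm_cast; rw [sub_eq_zero, eq_comm]

lemma g_inr_eq_zero {P : BoxProblem n} {θ : Fin n → ℝ} {i : Fin n} :
    P.g θ (Sum.inr i) = 0 ↔ P.lo i = θ i := by
  simp only [g]
  induction P.lo i with
  | bot => simp
  | top => simp [← EReal.coe_neg]
  | coe x => norm_cast; rw [neg_add_eq_zero, eq_comm]

lemma g_inl_nonpos {P : BoxProblem n} {θ : Fin n → ℝ} {i : Fin n} :
    P.g θ (Sum.inl i) ≤ 0 ↔ (θ i : EReal) ≤ P.hi i := by
  simp only [g]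
  induction P.hi i with
  | bot => simp
  | top => simp
  | coe x => norm_cast; rw [sub_nonpos]

lemma g_inr_nonpos {P : BoxProblem n} {θ : Fin n → ℝ} {i : Fin n} :
    P.g θ (Sum.inr i) ≤ 0 ↔ P.lo i ≤ θ i := by
  simp only [g]
  induction P.lo i with
  | bot => simp
  | top => simp [← EReal.coe_neg]
  | coe x => norm_cast; constructor <;> intro h <;> linarith

lemma mem_feasibleSet {P : BoxProblem n} {θ : Fin n → ℝ} :
    θ ∈ P.feasibleSet ↔ ∀ i, P.lo i ≤ θ i ∧ (θ i : EReal) ≤ P.hi i := by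
  simp only [feasibleSet, Set.mem_ofPred_eq, Sum.forall, g_inl_nonpos, g_inr_nonpos]
  exact ⟨fun h i => ⟨h.2 i, h.1 i⟩, fun h => ⟨fun i => (h i).2, fun i => (h i).1⟩⟩

lemma not_mem_active_inr_of_inl {P : BoxProblem n} (hbd : ∀ i, P.lo i < P.hi i)
    {θ : Fin n → ℝ} {i : Fin n} (h : Sum.inl i ∈ P.active θ) : Sum.inr i ∉ P.active θ := by
  rw [mem_active, g_inl_eq_zero] at h
  rw [mem_active, g_inr_eq_zero]
  intro h'
  exact (hbd i).ne (h'.trans h.symm)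

lemma isClosed_feasibleSet (P : BoxProblem n) : IsClosed P.feasibleSet := by
  have : P.feasibleSet = ⋂ i, {θ : Fin n → ℝ | P.lo i ≤ θ i} ∩ {θ | (θ i : EReal) ≤ P.hi i} := by
    ext θ
    simp [mem_feasibleSet]
  rw [this]
  refine isClosed_iInter fun i => ?_
  have hc : Continuous fun θ : Fin n → ℝ => (θ i : EReal) :=
    continuous_coe_real_ereal.comp (continuous_apply i)
  exact (isClosed_le continuous_const hc).inter (isClosed_le hc continuous_const)

/-- A constraint that is inactive at a point is inactive nearby. -/
lemma eventually_active_subset (P : BoxProblem n) (p : Fin n → ℝ) :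
    ∀ᶠ θ in 𝓝 p, P.active θ ⊆ P.active p := by
  have hc : ∀ i, Continuous fun θ : Fin n → ℝ => (θ i : EReal) := fun i =>
    continuous_coe_real_ereal.comp (continuous_apply i)
  have key : ∀ j, j ∉ P.active p → ∀ᶠ θ in 𝓝 p, j ∉ P.active θ := by
    rintro (i | i) hj
    · rw [mem_active, g_inl_eq_zero] at hj
      filter_upwards [(hc i).continuousAt.eventually_ne (Ne.symm hj)] with θ hθ
      rw [mem_active, g_inl_eq_zero]
      exact Ne.symm hθ
    · rw [mem_active, g_inr_eq_zero] at hj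
      filter_upwards [(hc i).continuousAt.eventually_ne (Ne.symm hj)] with θ hθ
      rw [mem_active, g_inr_eq_zero]
      exact Ne.symm hθ
  have : ∀ᶠ θ in 𝓝 p, ∀ j, j ∉ P.active p → j ∉ P.active θ := by
    rw [eventually_all]
    intro j
    by_cases hj : j ∈ P.active p
    · simp [hj]
    · simpa [hj] using key j hj
  filter_upwards [this] with θ hθ j hj
  by_contra h
  exact hθ j h hj

/-! ### The quadratic program -/

section QP

variable {P : BoxProblem n} {K : Matrix (Fin n) (Fin n) ℝ} {θ : Fin n → ℝ}

lemma zero_mem_qpFeasible : (0 : Fin n → ℝ) ∈ P.qpFeasible θ := by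
  intro j _
  simp

lemma add_smul_mem_qpFeasible {u v : Fin n → ℝ} (hu : u ∈ P.qpFeasible θ)
    (hv : v ∈ P.qpFeasible θ) {t : ℝ} (ht : 0 ≤ t) : u + t • v ∈ P.qpFeasible θ := by
  intro j hj
  have h1 := hu j hj
  have h2 := hv j hj
  simp only [Matrix.mulVec_add, Matrix.mulVec_smul, Pi.add_apply, Pi.smul_apply, smul_eq_mul]
  nlinarith

lemma smul_mem_qpFeasible {u : Fin n → ℝ} (hu : u ∈ P.qpFeasible θ) {t : ℝ} (ht : 0 ≤ t) :
    t • u ∈ P.qpFeasible θ := by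
  simpa using add_smul_mem_qpFeasible zero_mem_qpFeasible hu ht

lemma isClosed_qpFeasible : IsClosed (P.qpFeasible θ) := by
  have : P.qpFeasible θ = ⋂ j ∈ P.active θ, {u | (gJac n *ᵥ u) j ≤ 0} := by
    ext u
    simp [qpFeasible]
  rw [this]
  refine isClosed_biInter fun j _ => isClosed_le ?_ continuous_const
  fun_prop

/-- Coercivity: beyond the radius `R` the quadratic term dominates the linear one, so the objective
is at least its value `0` at the origin, and minimizing over a compact ball suffices. -/
lemma exists_isQPSolution (hK : K.PosDef) : ∃ u, P.IsQPSolution K θ u := by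
  obtain ⟨m, hm, hmK⟩ := hK.inv.exists_pos_mul_sq_norm_le
  set R : ℝ := 2 * n * ‖P.grad θ‖ / m with hR
  have hR0 : 0 ≤ R := by positivity
  have hcont : Continuous (P.qpObjective K θ) := by
    unfold qpObjective
    fun_prop
  obtain ⟨u, hu, hmin⟩ := ((isCompact_closedBall (0 : Fin n → ℝ) R).inter_left
    (isClosed_qpFeasible (P := P) (θ := θ))).exists_isMinOn ⟨0, zero_mem_qpFeasible, by simpa⟩
    hcont.continuousOn
  refine ⟨u, hu.1, fun v hv => ?_⟩
  by_cases hvR : ‖v‖ ≤ R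
  · exact hmin ⟨hv, by simpa using hvR⟩
  · have h0 : P.qpObjective K θ u ≤ P.qpObjective K θ 0 := hmin ⟨zero_mem_qpFeasible, by simpa⟩
    have h1 := neg_le_of_abs_le (abs_dotProduct_le_card_mul_norm (P.grad θ) v)
    have h2 := hmK v
    have h3 : 2 * n * ‖P.grad θ‖ ≤ m * ‖v‖ := by
      rw [← div_le_iff₀' hm]
      exact (not_le.1 hvR).le
    have h4 := mul_le_mul_of_nonneg_right h3 (norm_nonneg v)
    simp only [qpObjective, dotProduct_zero, zero_dotProduct, mul_zero, add_zero] at h0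
    simp only [Set.mem_ofPred_eq]
    refine h0.trans ?_
    simp only [qpObjective]
    nlinarith

/-- The variational inequality that characterizes the solution of the quadratic program. -/
lemma IsQPSolution.variational {u : Fin n → ℝ} (hK : K.PosDef) (hu : P.IsQPSolution K θ u) :
    (∀ v ∈ P.qpFeasible θ, 0 ≤ (P.grad θ + K⁻¹ *ᵥ u) ⬝ᵥ v) ∧
      (P.grad θ + K⁻¹ *ᵥ u) ⬝ᵥ u = 0 := by
  have expand : ∀ (v : Fin n → ℝ) (t : ℝ), P.qpObjective K θ (u + t • v) =
      P.qpObjective K θ u + t * (1 / 2 * ((P.grad θ + K⁻¹ *ᵥ u) ⬝ᵥ v)) +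
        t ^ 2 * (1 / 4 * (v ⬝ᵥ (K⁻¹ *ᵥ v))) := by
    intro v t
    have := hK.inv.dotProduct_mulVec_comm u v
    simp only [qpObjective, Matrix.mulVec_add, Matrix.mulVec_smul, dotProduct_add, add_dotProduct,
      dotProduct_smul, smul_dotProduct, smul_eq_mul, dotProduct_comm (K⁻¹ *ᵥ u) v, this]
    ring
  have slope : ∀ a b : ℝ, (∀ t : ℝ, 0 < t → t ≤ 1 → 0 ≤ t * a + t ^ 2 * b) → 0 ≤ a := by
    intro a b h
    have hlim : Tendsto (fun t : ℝ => a + t * b) (𝓝[>] 0) (𝓝 (a + 0 * b)) :=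
      ((continuous_const.add (continuous_id.mul continuous_const)).tendsto 0).mono_left
        nhdsWithin_le_nhds
    rw [zero_mul, add_zero] at hlim
    refine ge_of_tendsto hlim ?_
    filter_upwards [Ioc_mem_nhdsGT one_pos] with t ht
    have := h t ht.1 ht.2
    have ht0 : 0 < t := ht.1
    by_contra hneg
    nlinarith [not_le.1 hneg]
  have hdir : ∀ v, (∀ t : ℝ, 0 < t → t ≤ 1 → u + t • v ∈ P.qpFeasible θ) →
      0 ≤ (P.grad θ + K⁻¹ *ᵥ u) ⬝ᵥ v := by
    intro v hv
    have := slope (1 / 2 * ((P.grad θ + K⁻¹ *ᵥ u) ⬝ᵥ v)) (1 / 4 * (v ⬝ᵥ (K⁻¹ *ᵥ v)))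
      fun t ht ht1 => by
        have hmin := hu.2 (hv t ht ht1)
        simp only [Set.mem_ofPred_eq, expand v t] at hmin
        linarith
    linarith
  have h1 : ∀ v ∈ P.qpFeasible θ, 0 ≤ (P.grad θ + K⁻¹ *ᵥ u) ⬝ᵥ v := fun v hv =>
    hdir v fun t ht _ => add_smul_mem_qpFeasible hu.1 hv ht.le
  refine ⟨h1, le_antisymm ?_ (h1 u hu.1)⟩
  -- The feasible controls form a cone, so `u - t u = (1 - t) u` is feasible for `t ≤ 1`. Moving
  -- both ways along `u` turns the inequality into an equality.
  have := hdir (-u) fun t ht ht1 => by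
    have := smul_mem_qpFeasible hu.1 (sub_nonneg.2 ht1)
    convert this using 1
    module
  rw [dotProduct_neg] at this
  linarith

/-- Testing the variational inequality of each solution with the other one and adding, the gradient
cancels and `(u - v) ⬝ K⁻¹ (u - v) ≤ 0` remains. -/
lemma IsQPSolution.unique {u v : Fin n → ℝ} (hK : K.PosDef) (hu : P.IsQPSolution K θ u)
    (hv : P.IsQPSolution K θ v) : u = v := by
  by_contra hne
  have hpos : 0 < (u - v) ⬝ᵥ (K⁻¹ *ᵥ (u - v)) := by
    simpa using hK.inv.dotProduct_mulVec_pos (sub_ne_zero.2 hne)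
  obtain ⟨hu1, hu2⟩ := hu.variational hK
  obtain ⟨hv1, hv2⟩ := hv.variational hK
  have h1 := hu1 v hv.1
  have h2 := hv1 u hu.1
  have h3 := hK.inv.dotProduct_mulVec_comm u v
  simp only [Matrix.mulVec_sub, dotProduct_sub, sub_dotProduct] at hpos
  simp only [add_dotProduct] at h1 h2 hu2 hv2
  rw [dotProduct_comm (K⁻¹ *ᵥ _)] at h1 h2 hu2 hv2
  linarith

lemma mem_qpActive_iff {u : Fin n → ℝ} (hK : K.PosDef) (hu : P.IsQPSolution K θ u)
    {j : Fin n ⊕ Fin n} :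
    j ∈ P.qpActive K θ ↔ j ∈ P.active θ ∧ (gJac n *ᵥ u) j = 0 := by
  simp only [qpActive, Finset.mem_filter]
  refine and_congr_right fun _ => ⟨?_, fun h => ⟨u, hu, h⟩⟩
  rintro ⟨v, hv, h⟩
  rwa [hu.unique hK hv]

lemma qpActive_subset_active : P.qpActive K θ ⊆ P.active θ := by
  classical
  exact Finset.filter_subset _ _

/-- The unit vectors that point into the feasible region are feasible controls. -/
lemma single_mem_qpFeasible {i : Fin n} (h : Sum.inl i ∉ P.active θ) :
    Pi.single i 1 ∈ P.qpFeasible θ := by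
  rintro (k | k) hk
  · have : k ≠ i := by rintro rfl; exact h hk
    simp [this]
  · by_cases hki : k = i
    · subst hki; simp
    · simp [hki]

lemma neg_single_mem_qpFeasible {i : Fin n} (h : Sum.inr i ∉ P.active θ) :
    -Pi.single i 1 ∈ P.qpFeasible θ := by
  rintro (k | k) hk
  · by_cases hki : k = i
    · subst hki; simp
    · simp [hki]
  · have : k ≠ i := by rintro rfl; exact h hk
    simp [this]

end QP

end BoxProblem

/-! ### Multipliers, residual and the normal cone -/

namespace BoxProblem

variable {n : ℕ}

/-- The nonnegative multipliers, at most one of them nonzero in each coordinate, whose image under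
the transposed constraint Jacobian is `w`. -/
def signedParts (w : Fin n → ℝ) : Fin n ⊕ Fin n → ℝ :=
  Sum.elim (fun i => max (w i) 0) (fun i => max (-w i) 0)

lemma continuous_signedParts : Continuous (signedParts (n := n)) := by
  refine continuous_pi ?_
  rintro (i | i) <;> simp only [signedParts, Sum.elim_inl, Sum.elim_inr] <;> fun_prop

lemma signedParts_nonneg (w : Fin n → ℝ) (j : Fin n ⊕ Fin n) : 0 ≤ signedParts w j := by
  rcases j with i | i <;> simp [signedParts]

lemma gJac_transpose_mulVec_signedParts (w : Fin n → ℝ) :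
    (gJac n)ᵀ *ᵥ signedParts w = w := by
  ext i
  rw [gJac_transpose_mulVec]
  simp only [signedParts, Sum.elim_inl, Sum.elim_inr]
  rcases le_total 0 (w i) with h | h
  · rw [max_eq_left h, max_eq_right (by linarith)]; ring
  · rw [max_eq_right h, max_eq_left (by linarith)]; ring

/-- The two bounds of a coordinate are never both active, so the difference of its two multipliers
determines both. -/
lemma eq_signedParts {P : BoxProblem n} (hbd : ∀ i, P.lo i < P.hi i) {θ : Fin n → ℝ}
    {π : Fin n ⊕ Fin n → ℝ} (h0 : ∀ j, 0 ≤ π j) (hoff : ∀ j ∉ P.active θ, π j = 0) :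
    π = signedParts ((gJac n)ᵀ *ᵥ π) := by
  have key : ∀ i, π (Sum.inl i) = 0 ∨ π (Sum.inr i) = 0 := fun i => by
    by_cases h : Sum.inl i ∈ P.active θ
    · exact Or.inr (hoff _ (not_mem_active_inr_of_inl hbd h))
    · exact Or.inl (hoff _ h)
  ext j
  rcases j with i | i <;>
    simp only [signedParts, Sum.elim_inl, Sum.elim_inr, gJac_transpose_mulVec] <;>
    rcases key i with h | h <;> simp [h, h0]

lemma hJac_transpose_mulVec_restrict (S : Finset (Fin n ⊕ Fin n)) {π : Fin n ⊕ Fin n → ℝ}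
    (h : ∀ j ∉ S, π j = 0) : (hJac S)ᵀ *ᵥ (fun j : S => π j) = (gJac n)ᵀ *ᵥ π := by
  ext i
  simp only [Matrix.mulVec, dotProduct, hJac, Matrix.transpose_apply, Matrix.submatrix_apply, id]
  rw [Finset.sum_coe_sort S (fun j => gJac n j i * π j)]
  refine Finset.sum_subset (Finset.subset_univ S) fun j _ hj => ?_
  rw [h j hj, mul_zero]

section

variable {P : BoxProblem n} {K : Matrix (Fin n) (Fin n) ℝ} {θ : Fin n → ℝ}

/-- The rows are signed unit vectors, with at most one per coordinate because `lo i < hi i`; hence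
they are linearly independent. -/
lemma posDef_hJac_mul_mul_transpose (hbd : ∀ i, P.lo i < P.hi i) (hK : K.PosDef)
    {S : Finset (Fin n ⊕ Fin n)} (hS : S ⊆ P.active θ) :
    (hJac S * K * (hJac S)ᵀ).PosDef := by
  classical
  rw [← Matrix.conjTranspose_eq_transpose_of_trivial]
  refine hK.mul_mul_conjTranspose_same ?_
  have hz : ∀ x : S → ℝ, x ᵥ* hJac S = 0 → x = 0 := by
    intro x hx
    set π : Fin n ⊕ Fin n → ℝ := fun j => if hj : j ∈ S then x ⟨j, hj⟩ else 0 with hπ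
    have hoff : ∀ j ∉ S, π j = 0 := fun j hj => by simp [hπ, hj]
    have hres : (fun j : S => π j) = x := by ext j; simp [hπ]
    have h1 := hJac_transpose_mulVec_restrict S hoff
    rw [hres, Matrix.mulVec_transpose, hx] at h1
    ext ⟨j, hj⟩
    have hx' : x ⟨j, hj⟩ = π j := by simp [hπ, hj]
    rw [hx', Pi.zero_apply]
    rcases j with i | i
    · have h2 := congrFun h1 i
      rw [gJac_transpose_mulVec, hoff _ fun h => not_mem_active_inr_of_inl hbd (hS hj) (hS h)] at h2
      simpa using h2.symm
    · have h2 := congrFun h1 i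
      rw [gJac_transpose_mulVec, hoff (Sum.inl i)
        fun h => not_mem_active_inr_of_inl hbd (hS h) (hS hj)] at h2
      simpa using h2.symm
  intro x y hxy
  refine sub_eq_zero.1 (hz _ ?_)
  rw [Matrix.sub_vecMul]
  exact sub_eq_zero.2 hxy

/-- Unit directions as test vectors show that a nonzero `w i` forces the bound of matching sign to
be active, which fixes the sign of `u i`. All products `w i * u i` are then nonnegative, and their
sum is zero. -/
lemma IsQPSolution.complementarity {u : Fin n → ℝ} (hK : K.PosDef) (hu : P.IsQPSolution K θ u) :
    (∀ j ∉ P.active θ, signedParts (-(P.grad θ + K⁻¹ *ᵥ u)) j = 0) ∧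
      ∀ j, signedParts (-(P.grad θ + K⁻¹ *ᵥ u)) j * (gJac n *ᵥ u) j = 0 := by
  obtain ⟨hvar, hort⟩ := hu.variational hK
  set w := P.grad θ + K⁻¹ *ᵥ u with hw
  have hl : ∀ i, Sum.inl i ∉ P.active θ → 0 ≤ w i := fun i hi => by
    simpa using hvar _ (single_mem_qpFeasible hi)
  have hr : ∀ i, Sum.inr i ∉ P.active θ → w i ≤ 0 := fun i hi => by
    simpa using hvar _ (neg_single_mem_qpFeasible hi)
  have hnn : ∀ i, 0 ≤ w i * u i := by
    intro i
    rcases lt_trichotomy (w i) 0 with h | h | h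
    · have := hu.1 (Sum.inl i) (by by_contra hi; linarith [hl i hi])
      rw [gJac_mulVec_inl] at this
      exact mul_nonneg_of_nonpos_of_nonpos h.le this
    · simp [h]
    · have := hu.1 (Sum.inr i) (by by_contra hi; linarith [hr i hi])
      rw [gJac_mulVec_inr] at this
      exact mul_nonneg h.le (by linarith)
  have hz : ∀ i, w i * u i = 0 := fun i =>
    (Finset.sum_eq_zero_iff_of_nonneg fun i _ => hnn i).1 hort i (Finset.mem_univ i)
  constructor
  · rintro (i | i) hi
    · simpa [signedParts] using hl i hi
    · simpa [signedParts] using hr i hi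
  · rintro (i | i) <;> rcases mul_eq_zero.1 (hz i) with h | h <;> simp [signedParts, h]

/-- By complementarity the signed parts vanish off the optimal active set. With `h` the Jacobian
there, `hᵀ π = -(∇f + K⁻¹ u)` and `h u = 0`, so `h K hᵀ π = -h K ∇f`, an invertible system. -/
lemma multiplier_eq_signedParts {u : Fin n → ℝ} (hbd : ∀ i, P.lo i < P.hi i) (hK : K.PosDef)
    (hu : P.IsQPSolution K θ u) :
    P.multiplier K θ = signedParts (-(P.grad θ + K⁻¹ *ᵥ u)) := by
  obtain ⟨hoff, hcomp⟩ := hu.complementarity hK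
  set π := signedParts (-(P.grad θ + K⁻¹ *ᵥ u)) with hπ
  set S := P.qpActive K θ with hS
  have hoffS : ∀ j ∉ S, π j = 0 := by
    intro j hj
    by_cases hja : j ∈ P.active θ
    · refine (mul_eq_zero.1 (hcomp j)).resolve_right fun h => hj ?_
      exact (mem_qpActive_iff hK hu).2 ⟨hja, h⟩
    · exact hoff j hja
  have hpd := posDef_hJac_mul_mul_transpose hbd hK (qpActive_subset_active (P := P) (K := K)
    (θ := θ))
  have hSu : hJac S *ᵥ u = 0 := by
    ext ⟨j, hj⟩
    exact ((mem_qpActive_iff hK hu).1 hj).2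
  have hKu : K *ᵥ (K⁻¹ *ᵥ u) = u := by
    rw [Matrix.mulVec_mulVec, Matrix.mul_nonsing_inv _ ((Matrix.isUnit_iff_isUnit_det K).1 hK.isUnit),
      Matrix.one_mulVec]
  have hform : multiplierFormula S K (P.grad θ) = fun j : S => π j := by
    have h1 : (hJac S * K * (hJac S)ᵀ) *ᵥ (fun j : S => π j) =
        -(hJac S *ᵥ (K *ᵥ P.grad θ)) := by
      rw [← Matrix.mulVec_mulVec, ← Matrix.mulVec_mulVec, hJac_transpose_mulVec_restrict S hoffS,
        hπ, gJac_transpose_mulVec_signedParts, Matrix.mulVec_neg, Matrix.mulVec_add, hKu,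
        Matrix.mulVec_neg, Matrix.mulVec_add, hSu, add_zero]
    rw [multiplierFormula, ← Matrix.mulVec_neg, ← h1, Matrix.mulVec_mulVec,
      Matrix.nonsing_inv_mul _ ((Matrix.isUnit_iff_isUnit_det _).1 hpd.isUnit), Matrix.one_mulVec]
  ext j
  by_cases hj : j ∈ S
  · rw [multiplier, dif_pos hj]
    exact congrFun hform ⟨j, hj⟩
  · rw [multiplier, dif_neg hj, hoffS j hj]

lemma multiplier_nonneg (hbd : ∀ i, P.lo i < P.hi i) (hK : K.PosDef) (j : Fin n ⊕ Fin n) :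
    0 ≤ P.multiplier K θ j := by
  obtain ⟨u, hu⟩ := exists_isQPSolution (P := P) (θ := θ) hK
  rw [multiplier_eq_signedParts hbd hK hu]
  exact signedParts_nonneg _ _

lemma multiplier_eq_zero {j : Fin n ⊕ Fin n} (hj : j ∉ P.active θ) :
    P.multiplier K θ j = 0 := by
  simp only [multiplier]
  rw [dif_neg fun h => hj (qpActive_subset_active h)]

lemma multiplier_eq_signedParts_residual (hbd : ∀ i, P.lo i < P.hi i) (hK : K.PosDef) :
    P.multiplier K θ = signedParts (P.residual K θ - P.grad θ) := by
  have := eq_signedParts hbd (multiplier_nonneg (P := P) (θ := θ) hbd hK)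
    fun _ => multiplier_eq_zero
  rwa [residual, add_sub_cancel_left]

/-- The velocity of the dynamics is the optimal solution of the quadratic program. -/
lemma isQPSolution_neg_mulVec_residual (hbd : ∀ i, P.lo i < P.hi i) (hK : K.PosDef) :
    P.IsQPSolution K θ (-(K *ᵥ P.residual K θ)) := by
  obtain ⟨u, hu⟩ := exists_isQPSolution (P := P) (θ := θ) hK
  have hr : P.residual K θ = -(K⁻¹ *ᵥ u) := by
    rw [residual, multiplier_eq_signedParts hbd hK hu, gJac_transpose_mulVec_signedParts]
    abel
  rwa [hr, Matrix.mulVec_neg, neg_neg, Matrix.mulVec_mulVec,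
    Matrix.mul_nonsing_inv _ ((Matrix.isUnit_iff_isUnit_det K).1 hK.isUnit), Matrix.one_mulVec]

/-- The energy identity: the right side is minus the derivative of the objective along the dynamics,
the left side is positive unless the residual vanishes. -/
lemma residual_dotProduct_mulVec (hbd : ∀ i, P.lo i < P.hi i) (hK : K.PosDef) :
    P.residual K θ ⬝ᵥ (K *ᵥ P.residual K θ) = P.grad θ ⬝ᵥ (K *ᵥ P.residual K θ) := by
  have hu := isQPSolution_neg_mulVec_residual (P := P) (θ := θ) hbd hK
  have h := (hu.variational hK).2
  rw [Matrix.mulVec_neg, Matrix.mulVec_mulVec,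
    Matrix.nonsing_inv_mul _ ((Matrix.isUnit_iff_isUnit_det K).1 hK.isUnit), Matrix.one_mulVec,
    dotProduct_neg, add_dotProduct, neg_dotProduct] at h
  linarith

lemma residual_le_grad (hbd : ∀ i, P.lo i < P.hi i) (hK : K.PosDef) {i : Fin n}
    (hi : Sum.inl i ∉ P.active θ) : P.residual K θ i ≤ P.grad θ i := by
  have := multiplier_nonneg (P := P) (θ := θ) hbd hK (Sum.inr i)
  simp only [residual, Pi.add_apply, gJac_transpose_mulVec, multiplier_eq_zero hi]
  linarith

lemma grad_le_residual (hbd : ∀ i, P.lo i < P.hi i) (hK : K.PosDef) {i : Fin n}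
    (hi : Sum.inr i ∉ P.active θ) : P.grad θ i ≤ P.residual K θ i := by
  have := multiplier_nonneg (P := P) (θ := θ) hbd hK (Sum.inl i)
  simp only [residual, Pi.add_apply, gJac_transpose_mulVec, multiplier_eq_zero hi]
  linarith

/-- The vector `-c` lies in the normal cone of the box at `θ`.  For `c` the gradient at `θ`, these
are the KKT conditions. -/
def NegMemNormalCone (P : BoxProblem n) (θ c : Fin n → ℝ) : Prop :=
  ∀ i, (c i < 0 → Sum.inl i ∈ P.active θ) ∧ (0 < c i → Sum.inr i ∈ P.active θ)

lemma NegMemNormalCone.of_active_subset {q c : Fin n → ℝ} (h : P.NegMemNormalCone θ c)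
    (hq : P.active θ ⊆ P.active q) : P.NegMemNormalCone q c :=
  fun i => ⟨fun hi => hq ((h i).1 hi), fun hi => hq ((h i).2 hi)⟩

lemma NegMemNormalCone.dotProduct_nonneg {c u : Fin n → ℝ} (h : P.NegMemNormalCone θ c)
    (hu : u ∈ P.qpFeasible θ) : 0 ≤ c ⬝ᵥ u := by
  refine Finset.sum_nonneg fun i _ => ?_
  rcases lt_trichotomy (c i) 0 with hi | hi | hi
  · have := hu _ ((h i).1 hi)
    rw [gJac_mulVec_inl] at this
    exact mul_nonneg_of_nonpos_of_nonpos hi.le this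
  · simp [hi]
  · have := hu _ ((h i).2 hi)
    rw [gJac_mulVec_inr] at this
    exact mul_nonneg hi.le (by linarith)

lemma isClosed_setOf_negMemNormalCone (P : BoxProblem n) (c : Fin n → ℝ) :
    IsClosed {θ | P.NegMemNormalCone θ c} := by
  have hc : ∀ i, Continuous fun θ : Fin n → ℝ => (θ i : EReal) := fun i =>
    continuous_coe_real_ereal.comp (continuous_apply i)
  have : {θ | P.NegMemNormalCone θ c} =
      ⋂ i, {θ | c i < 0 → P.hi i = θ i} ∩ {θ | 0 < c i → P.lo i = θ i} := by
    ext θ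
    simp [NegMemNormalCone, mem_active, g_inl_eq_zero, g_inr_eq_zero]
  rw [this]
  refine isClosed_iInter fun i => IsClosed.inter ?_ ?_
  · by_cases h : c i < 0
    · simpa [h] using isClosed_eq continuous_const (hc i)
    · simp [h]
  · by_cases h : 0 < c i
    · simpa [h] using isClosed_eq continuous_const (hc i)
    · simp [h]

lemma IsKKTMultiplier.negMemNormalCone {π : Fin n ⊕ Fin n → ℝ} (h : P.IsKKTMultiplier θ π) :
    P.NegMemNormalCone θ (P.grad θ) := by
  obtain ⟨h1, h2, h3⟩ := h
  have hnn : ∀ j, 0 ≤ π j := fun j => by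
    by_cases hj : j ∈ P.active θ
    · exact h2 j hj
    · exact (h3 j hj).ge
  intro i
  have hi := congrFun h1 i
  rw [Pi.add_apply, gJac_transpose_mulVec, Pi.zero_apply] at hi
  constructor <;> intro hlt <;> by_contra hj <;> have := h3 _ hj
  · linarith [hnn (Sum.inr i)]
  · linarith [hnn (Sum.inl i)]

lemma NegMemNormalCone.residual_eq_zero (h : P.NegMemNormalCone θ (P.grad θ))
    (hbd : ∀ i, P.lo i < P.hi i) (hK : K.PosDef) : P.residual K θ = 0 := by
  by_contra hne
  have hpos : 0 < P.residual K θ ⬝ᵥ (K *ᵥ P.residual K θ) := by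
    simpa using hK.dotProduct_mulVec_pos hne
  rw [residual_dotProduct_mulVec hbd hK] at hpos
  have := h.dotProduct_nonneg (isQPSolution_neg_mulVec_residual (P := P) (θ := θ) hbd hK).1
  rw [dotProduct_neg] at this
  linarith

lemma NegMemNormalCone.multiplier_eq (h : P.NegMemNormalCone θ (P.grad θ)) (hbd : ∀ i, P.lo i < P.hi i)
    (hK : K.PosDef) : P.multiplier K θ = signedParts (-P.grad θ) := by
  rw [multiplier_eq_signedParts_residual hbd hK, h.residual_eq_zero hbd hK, zero_sub]

lemma NegMemNormalCone.isKKTMultiplier (h : P.NegMemNormalCone θ (P.grad θ)) (hbd : ∀ i, P.lo i < P.hi i)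
    (hK : K.PosDef) : P.IsKKTMultiplier θ (P.multiplier K θ) :=
  ⟨h.residual_eq_zero hbd hK, fun j _ => multiplier_nonneg hbd hK j, fun _ => multiplier_eq_zero⟩

lemma NegMemNormalCone.qpActive_eq (h : P.NegMemNormalCone θ (P.grad θ)) (hbd : ∀ i, P.lo i < P.hi i)
    (hK : K.PosDef) : P.qpActive K θ = P.active θ := by
  have hu := isQPSolution_neg_mulVec_residual (P := P) (θ := θ) hbd hK
  rw [h.residual_eq_zero hbd hK, Matrix.mulVec_zero, neg_zero] at hu
  ext j
  simp [mem_qpActive_iff hK hu]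

lemma NegMemNormalCone.mem_kktSet (h : P.NegMemNormalCone θ (P.grad θ)) (hbd : ∀ i, P.lo i < P.hi i)
    (hθ : θ ∈ P.feasibleSet) : θ ∈ P.kktSet :=
  ⟨hθ, _, h.isKKTMultiplier hbd Matrix.PosDef.one⟩

lemma convex_feasibleSet : Convex ℝ P.feasibleSet := by
  have : P.feasibleSet = Set.pi Set.univ fun i => {x : ℝ | P.lo i ≤ x ∧ (x : EReal) ≤ P.hi i} := by
    ext θ
    simp [mem_feasibleSet]
  rw [this]
  refine convex_pi fun i _ => Set.OrdConnected.convex ⟨fun x hx y hy z hz => ⟨?_, ?_⟩⟩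
  · exact hx.1.trans (EReal.coe_le_coe_iff.2 hz.1)
  · exact (EReal.coe_le_coe_iff.2 hz.2).trans hy.2

lemma exists_pos_add_smul_single_mem (hθ : θ ∈ P.feasibleSet) {i : Fin n}
    (hi : Sum.inl i ∉ P.active θ) : ∃ t : ℝ, 0 < t ∧ θ + t • Pi.single i 1 ∈ P.feasibleSet := by
  rw [mem_active, g_inl_eq_zero] at hi
  rw [mem_feasibleSet] at hθ
  obtain ⟨x, hx1, hx2⟩ := EReal.lt_iff_exists_real_btwn.1 (lt_of_le_of_ne (hθ i).2 (Ne.symm hi))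
  have hx : θ i < x := EReal.coe_lt_coe_iff.1 hx1
  refine ⟨x - θ i, sub_pos.2 hx, mem_feasibleSet.2 fun k => ?_⟩
  by_cases hk : k = i
  · subst hk
    simp only [Pi.add_apply, Pi.smul_apply, Pi.single_eq_same, smul_eq_mul, mul_one,
      add_sub_cancel]
    exact ⟨(hθ k).1.trans hx1.le, hx2.le⟩
  · simpa [hk] using hθ k

lemma exists_pos_sub_smul_single_mem (hθ : θ ∈ P.feasibleSet) {i : Fin n}
    (hi : Sum.inr i ∉ P.active θ) : ∃ t : ℝ, 0 < t ∧ θ + t • -Pi.single i 1 ∈ P.feasibleSet := by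
  rw [mem_active, g_inr_eq_zero] at hi
  rw [mem_feasibleSet] at hθ
  obtain ⟨x, hx1, hx2⟩ := EReal.lt_iff_exists_real_btwn.1 (lt_of_le_of_ne (hθ i).1 hi)
  have hx : x < θ i := EReal.coe_lt_coe_iff.1 hx2
  refine ⟨θ i - x, sub_pos.2 hx, mem_feasibleSet.2 fun k => ?_⟩
  by_cases hk : k = i
  · subst hk
    simp only [Pi.add_apply, Pi.smul_apply, Pi.neg_apply, Pi.single_eq_same, smul_eq_mul,
      mul_neg, mul_one, neg_sub, add_sub_cancel]
    exact ⟨hx1.le, hx2.le.trans (hθ k).2⟩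
  · simpa [hk] using hθ k

/-- For a box, the first-order condition need only be tested along coordinate directions whose bound
is inactive. -/
lemma negMemNormalCone_of_isMinOn (hf : ContDiff ℝ 1 P.f) (hθ : θ ∈ P.feasibleSet)
    (hmin : IsMinOn P.f P.feasibleSet θ) : P.NegMemNormalCone θ (P.grad θ) := by
  have hd : HasFDerivWithinAt P.f (fderiv ℝ P.f θ) P.feasibleSet θ :=
    ((hf.differentiable one_ne_zero) θ).hasFDerivAt.hasFDerivWithinAt
  have key : ∀ v : Fin n → ℝ, (∃ t : ℝ, 0 < t ∧ θ + t • v ∈ P.feasibleSet) →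
      0 ≤ fderiv ℝ P.f θ v := by
    rintro v ⟨t, ht, hv⟩
    have := hmin.localize.hasFDerivWithinAt_nonneg hd
      (mem_posTangentConeAt_of_segment_subset (convex_feasibleSet.segment_subset hθ hv))
    rw [map_smul, smul_eq_mul] at this
    exact nonneg_of_mul_nonneg_right this ht
  refine fun i => ⟨fun hlt => ?_, fun hlt => ?_⟩ <;> by_contra hi
  · exact hlt.not_ge (key _ (exists_pos_add_smul_single_mem hθ hi))
  · have := key _ (exists_pos_sub_smul_single_mem hθ hi)
    rw [map_neg] at this
    exact hlt.not_ge (neg_nonneg.1 this)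

end

end BoxProblem

/-! ### Absolutely continuous curves and continuous gain matrices -/

lemma LipschitzOnWith.comp_absolutelyContinuousOnInterval {X Y : Type*} [PseudoMetricSpace X]
    [PseudoMetricSpace Y] {C : NNReal} {f : X → Y} {s : Set X} {γ : ℝ → X} {a b : ℝ}
    (hf : LipschitzOnWith C f s) (hγ : AbsolutelyContinuousOnInterval γ a b)
    (hs : Set.MapsTo γ (Set.uIcc a b) s) :
    AbsolutelyContinuousOnInterval (fun t => f (γ t)) a b := by
  have hlim : Tendsto (fun E : ℕ × (ℕ → ℝ × ℝ) =>
      (C : ℝ) * ∑ i ∈ Finset.range E.1, dist (γ (E.2 i).1) (γ (E.2 i).2))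
      (AbsolutelyContinuousOnInterval.totalLengthFilter ⊓
        𝓟 (AbsolutelyContinuousOnInterval.disjWithin a b)) (𝓝 0) := by
    simpa using Tendsto.const_mul (C : ℝ) hγ
  refine squeeze_zero' (Eventually.of_forall fun E => by positivity) ?_ hlim
  filter_upwards [mem_inf_of_right (mem_principal_self _)] with E hE
  rw [Finset.mul_sum]
  refine Finset.sum_le_sum fun i hi => ?_
  exact hf.dist_le_mul _ (hs (hE.1 i hi).1) _ (hs (hE.1 i hi).2)

lemma AbsolutelyContinuousOnInterval.sub_le_mul_of_ae_hasDerivAt {f f' : ℝ → ℝ} {a b C : ℝ}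
    (hf : AbsolutelyContinuousOnInterval f a b) (hab : a ≤ b)
    (h : ∀ᵐ t, t ∈ Set.Ioo a b → HasDerivAt f (f' t) t ∧ f' t ≤ C) :
    f b - f a ≤ C * (b - a) := by
  rw [← hf.integral_deriv_eq_sub]
  calc ∫ t in a..b, deriv f t ≤ ∫ _t in a..b, C := by
        refine intervalIntegral.integral_mono_ae_restrict hab hf.intervalIntegrable_deriv
          intervalIntegrable_const ?_
        rw [← Measure.restrict_congr_set Ioo_ae_eq_Icc, EventuallyLE,
          ae_restrict_iff' measurableSet_Ioo]
        filter_upwards [h] with t ht hmem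
        rw [(ht hmem).1.deriv]
        exact (ht hmem).2
    _ = C * (b - a) := by simp [mul_comm]

lemma eventually_forall_abs_sub_apply_le {n : ℕ} {X : Type*} [TopologicalSpace X]
    {K : X → Matrix (Fin n) (Fin n) ℝ} {s : Set X} {p : X} (hK : ContinuousWithinAt K s p)
    {ε : ℝ} (hε : 0 < ε) : ∀ᶠ x in 𝓝[s] p, ∀ i j, |(K x - K p) i j| ≤ ε := by
  rw [eventually_all]
  intro i
  rw [eventually_all]
  intro j
  have h : Tendsto (fun x => K x i j) (𝓝[s] p) (𝓝 (K p i j)) :=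
    ((continuous_apply j).tendsto _).comp (((continuous_apply i).tendsto _).comp hK)
  filter_upwards [h (Metric.closedBall_mem_nhds _ hε)] with x hx
  simpa [Real.dist_eq] using hx

/-- Continuous families of positive definite matrices are locally uniformly positive definite and
bounded. -/
lemma ContinuousWithinAt.eventually_posDef_bounds {n : ℕ} {X : Type*} [TopologicalSpace X]
    {K : X → Matrix (Fin n) (Fin n) ℝ} {s : Set X} {p : X} (hK : ContinuousWithinAt K s p)
    (hp : (K p).PosDef) :
    ∃ m Λ : ℝ, 0 < m ∧ 0 ≤ Λ ∧ ∀ᶠ x in 𝓝[s] p,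
      (∀ v, m * ‖v‖ ^ 2 ≤ v ⬝ᵥ (K x *ᵥ v)) ∧ ∀ v, ‖K x *ᵥ v‖ ≤ Λ * ‖v‖ := by
  obtain ⟨m, hm, hmK⟩ := hp.exists_pos_mul_sq_norm_le
  obtain ⟨Λ, hΛ0, hΛ⟩ : ∃ Λ : ℝ, 0 ≤ Λ ∧ ∀ v, ‖K p *ᵥ v‖ ≤ Λ * ‖v‖ := by
    refine ⟨n * ∑ i, ∑ j, |K p i j|, by positivity, norm_mulVec_le_of_forall_abs_le (by positivity)
      fun i j => ?_⟩
    refine (Finset.single_le_sum (f := fun j => |K p i j|) (fun j _ => abs_nonneg _)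
      (Finset.mem_univ j)).trans ?_
    exact Finset.single_le_sum (f := fun i => ∑ j, |K p i j|)
      (fun i _ => Finset.sum_nonneg fun j _ => abs_nonneg _) (Finset.mem_univ i)
  -- An entrywise perturbation of size `ε` changes the quadratic form by at most `n * n * ε * ‖v‖ ^
  -- 2`, which costs half of `m`.
  set ε : ℝ := m / (2 * (n * n + 1)) with hε
  have hε0 : 0 < ε := by positivity
  have hnε : n * (n * ε) ≤ m / 2 := by
    have : (m / 2 : ℝ) = (n * n + 1) * ε := by rw [hε]; field_simp
    rw [this]
    nlinarith
  refine ⟨m / 2, Λ + n * ε, by positivity, by positivity, ?_⟩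
  filter_upwards [eventually_forall_abs_sub_apply_le hK hε0] with x hx
  have hd := norm_mulVec_le_of_forall_abs_le hε0.le hx
  have hsplit : ∀ v, K x *ᵥ v = K p *ᵥ v + (K x - K p) *ᵥ v := fun v => by
    rw [Matrix.sub_mulVec]; abel
  constructor
  · intro v
    have h1 := neg_le_of_abs_le (abs_dotProduct_le_card_mul_norm v ((K x - K p) *ᵥ v))
    have h2 : n * ‖v‖ * ‖(K x - K p) *ᵥ v‖ ≤ n * ‖v‖ * (n * ε * ‖v‖) := by
      gcongr
      exact hd v
    have h3 : n * (n * ε) * ‖v‖ ^ 2 ≤ m / 2 * ‖v‖ ^ 2 := by gcongr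
    rw [hsplit, dotProduct_add]
    nlinarith [hmK v]
  · intro v
    rw [hsplit, add_mul]
    exact (norm_add_le _ _).trans (add_le_add (hΛ v) (hd v))

/-! ### Speed and decrease of the objective along solutions -/

namespace BoxProblem

variable {n : ℕ} {P : BoxProblem n} {K : (Fin n → ℝ) → Matrix (Fin n) (Fin n) ℝ}

lemma continuous_grad (hf : ContDiff ℝ 1 P.f) : Continuous P.grad := by
  refine continuous_pi fun i => ?_
  exact (hf.continuous_fderiv one_ne_zero).clm_apply continuous_const

lemma fderiv_apply_eq_grad_dotProduct (P : BoxProblem n) (θ v : Fin n → ℝ) :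
    fderiv ℝ P.f θ v = P.grad θ ⬝ᵥ v := by
  have : v = ∑ i, v i • (Pi.single i 1 : Fin n → ℝ) := by
    ext k
    simp [Finset.sum_apply, Pi.single_apply]
  conv_lhs => rw [this]
  simp only [map_sum, map_smul, smul_eq_mul, dotProduct, grad]
  exact Finset.sum_congr rfl fun i _ => mul_comm _ _

/-- Local bounds for the dynamics near a feasible point `p`: the speed is bounded, and the rate of
decrease of the objective is bounded below wherever `-∇f(p)` is not in the normal cone. -/
lemma exists_local_bounds (hf : ContDiff ℝ 1 P.f) (hbd : ∀ i, P.lo i < P.hi i)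
    (hKcont : ContinuousOn K P.feasibleSet) (hKpos : ∀ p ∈ P.feasibleSet, (K p).PosDef)
    {p : Fin n → ℝ} (hp : p ∈ P.feasibleSet) :
    ∃ M δ : ℝ, 0 < M ∧ 0 < δ ∧ ∀ᶠ θ in 𝓝[P.feasibleSet] p,
      ‖K θ *ᵥ P.residual (K θ) θ‖ ≤ M ∧
      (¬ P.NegMemNormalCone θ (P.grad p) →
        δ ≤ P.residual (K θ) θ ⬝ᵥ (K θ *ᵥ P.residual (K θ) θ)) := by
  obtain ⟨m, Λ, hm, hΛ, hev⟩ := (hKcont p hp).eventually_posDef_bounds (hKpos p hp)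
  obtain ⟨ε, hε, hεc⟩ : ∃ ε : ℝ, 0 < ε ∧ ∀ i, P.grad p i ≠ 0 → 2 * ε ≤ |P.grad p i| := by
    have : ∀ᶠ ε : ℝ in 𝓝[>] 0, ∀ i, P.grad p i ≠ 0 → 2 * ε ≤ |P.grad p i| := by
      rw [eventually_all]
      intro i
      by_cases h : P.grad p i = 0
      · simp [h]
      · filter_upwards [Ioc_mem_nhdsGT (half_pos (abs_pos.2 h))] with ε hε _
        linarith [hε.2]
    obtain ⟨ε, h1, h2⟩ := (this.and self_mem_nhdsWithin).exists
    exact ⟨ε, h2, h1⟩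
  set C : ℝ := ‖P.grad p‖ + 1 with hC
  have hgrad : ∀ᶠ θ in 𝓝[P.feasibleSet] p, ‖P.grad θ - P.grad p‖ < min ε 1 := by
    refine nhdsWithin_le_nhds ?_
    have := (continuous_grad hf).continuousAt (x := p) (Metric.ball_mem_nhds _ (lt_min hε one_pos))
    filter_upwards [this] with θ hθ
    simpa [dist_eq_norm] using hθ
  -- The energy identity gives `m ‖r‖² ≤ ∇f ⬝ K r ≤ n C Λ ‖r‖`, which bounds `r` and then `K r`; the
  -- `+ 1` keeps the speed bound positive. The rate comes from `ε ≤ ‖r‖` off the face.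
  refine ⟨Λ * (n * C * Λ / m) + 1, m * ε ^ 2, by positivity, by positivity, ?_⟩
  filter_upwards [hev, hgrad, self_mem_nhdsWithin] with θ hθ hg hfeas
  have hK := hKpos θ hfeas
  set r := P.residual (K θ) θ with hr
  constructor
  · have h1 := hθ.1 r
    rw [hr, residual_dotProduct_mulVec hbd hK, ← hr] at h1
    have h2 := (le_abs_self _).trans (abs_dotProduct_le_card_mul_norm (P.grad θ) (K θ *ᵥ r))
    have h3 : ‖P.grad θ‖ ≤ C := by
      have := norm_sub_norm_le (P.grad θ) (P.grad p)
      have := hg.le.trans (min_le_right _ _)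
      linarith
    have h4 : n * ‖P.grad θ‖ * ‖K θ *ᵥ r‖ ≤ n * C * (Λ * ‖r‖) := by
      gcongr
      exact hθ.2 r
    have h5 : ‖r‖ ≤ n * C * Λ / m := by
      rw [le_div_iff₀ hm]
      rcases (norm_nonneg r).eq_or_lt with h0 | h0
      · rw [← h0, zero_mul]; positivity
      · nlinarith
    calc ‖K θ *ᵥ r‖ ≤ Λ * ‖r‖ := hθ.2 r
      _ ≤ Λ * (n * C * Λ / m) := by gcongr
      _ ≤ _ := by linarith
  · intro hN
    refine le_trans ?_ (hθ.1 r)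
    -- Off the face, some coordinate with `P.grad p i ≠ 0` lacks the active bound that could cancel
    -- it. The other multiplier only increases the size of `r i`, so at least `2 * ε - ε` survives.
    have hε' : ε ≤ ‖r‖ := by
      have hgi : ∀ i, |P.grad θ i - P.grad p i| ≤ ε := fun i =>
        (norm_le_pi_norm (P.grad θ - P.grad p) i).trans (hg.le.trans (min_le_left _ _))
      simp only [NegMemNormalCone, not_forall, not_and_or] at hN
      obtain ⟨i, ⟨hi, hj⟩ | ⟨hi, hj⟩⟩ := hN
      · have h1 := residual_le_grad hbd hK hj
        have h2 := hεc i hi.ne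
        rw [abs_of_neg hi] at h2
        have h3 := (abs_le.1 (hgi i)).2
        have h4 := neg_le_of_abs_le (norm_le_pi_norm r i)
        linarith
      · have h1 := grad_le_residual hbd hK hj
        have h2 := hεc i hi.ne'
        rw [abs_of_pos hi] at h2
        have h3 := (abs_le.1 (hgi i)).1
        have h4 := le_of_abs_le (norm_le_pi_norm r i)
        linarith
    gcongr

/-- Where `-∇f(p)` is in the normal cone, the residual is controlled by the change of the
gradient. -/
lemma mul_norm_residual_le {A : Matrix (Fin n) (Fin n) ℝ} {θ p : Fin n → ℝ} {m Λ : ℝ}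
    (hbd : ∀ i, P.lo i < P.hi i) (hA : A.PosDef)
    (hm : ∀ v, m * ‖v‖ ^ 2 ≤ v ⬝ᵥ (A *ᵥ v)) (hΛ0 : 0 ≤ Λ) (hΛ : ∀ v, ‖A *ᵥ v‖ ≤ Λ * ‖v‖)
    (hN : P.NegMemNormalCone θ (P.grad p)) :
    m * ‖P.residual A θ‖ ≤ n * Λ * ‖P.grad θ - P.grad p‖ := by
  -- The velocity `-A r` is a feasible control, so `∇f(p) ⬝ A r ≤ 0`, and `∇f(p)` may be subtracted
  -- from the gradient in the energy identity.
  have h0 := hN.dotProduct_nonneg (isQPSolution_neg_mulVec_residual (P := P) (θ := θ) hbd hA).1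
  have h1 := hm (P.residual A θ)
  rw [residual_dotProduct_mulVec hbd hA] at h1
  set r := P.residual A θ
  have h2 := (le_abs_self _).trans
    (abs_dotProduct_le_card_mul_norm (P.grad θ - P.grad p) (A *ᵥ r))
  have h3 : n * ‖P.grad θ - P.grad p‖ * ‖A *ᵥ r‖ ≤ n * ‖P.grad θ - P.grad p‖ * (Λ * ‖r‖) := by
    gcongr
    exact hΛ r
  rw [dotProduct_neg] at h0
  rw [sub_dotProduct] at h2
  rcases (norm_nonneg r).eq_or_lt with h4 | h4
  · rw [← h4, mul_zero]; positivity
  · nlinarith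

namespace IsSolution

variable {θ : ℝ → Fin n → ℝ}

lemma absolutelyContinuousOnInterval (h : P.IsSolution K θ) {a b : ℝ} (ha : 0 ≤ a) (hab : a ≤ b) :
    AbsolutelyContinuousOnInterval θ a b := by
  refine (h.absCont b (ha.trans hab)).mono ?_
  rw [Set.uIcc_of_le hab, Set.uIcc_of_le (ha.trans hab)]
  exact Set.Icc_subset_Icc_left ha

lemma continuousOn_Icc (h : P.IsSolution K θ) {a b : ℝ} (ha : 0 ≤ a) (hab : a ≤ b) :
    ContinuousOn θ (Set.Icc a b) := by
  simpa [Set.uIcc_of_le hab] using (h.absolutelyContinuousOnInterval ha hab).continuousOn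

lemma ae_hasDerivAt (h : P.IsSolution K θ) {a b : ℝ} (ha : 0 ≤ a) :
    ∀ᵐ t, t ∈ Set.Ioo a b → HasDerivAt θ (-(K (θ t) *ᵥ P.residual (K (θ t)) (θ t))) t := by
  filter_upwards [(ae_restrict_iff' measurableSet_Ici).1 h.eqn] with t ht hmem
  exact ht (ha.trans hmem.1.le)

lemma norm_sub_le (h : P.IsSolution K θ) {a b M : ℝ} (ha : 0 ≤ a) (hab : a ≤ b) (hM : 0 ≤ M)
    (hbound : ∀ t ∈ Set.Ioo a b, ‖K (θ t) *ᵥ P.residual (K (θ t)) (θ t)‖ ≤ M) :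
    ‖θ b - θ a‖ ≤ M * (b - a) := by
  refine (pi_norm_le_iff_of_nonneg (mul_nonneg hM (sub_nonneg.2 hab))).2 fun i => ?_
  have hL : LipschitzOnWith 1 (fun x : Fin n → ℝ => x i) Set.univ :=
    (LipschitzWith.mk_one fun x y => dist_le_pi_dist x y i).lipschitzOnWith
  have hac : AbsolutelyContinuousOnInterval (fun t => θ t i) a b :=
    hL.comp_absolutelyContinuousOnInterval
      (h.absolutelyContinuousOnInterval ha hab) (Set.mapsTo_univ _ _)
  have hd : ∀ᵐ t, t ∈ Set.Ioo a b → HasDerivAt (fun t => θ t i)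
      ((-(K (θ t) *ᵥ P.residual (K (θ t)) (θ t))) i) t := by
    filter_upwards [h.ae_hasDerivAt (b := b) ha] with t ht hmem
    exact hasDerivAt_pi.1 (ht hmem) i
  have hle : ∀ t ∈ Set.Ioo a b, |(K (θ t) *ᵥ P.residual (K (θ t)) (θ t)) i| ≤ M := fun t ht =>
    (norm_le_pi_norm (K (θ t) *ᵥ P.residual (K (θ t)) (θ t)) i).trans (hbound t ht)
  rw [Pi.sub_apply, Real.norm_eq_abs, abs_le']
  constructor
  · refine hac.sub_le_mul_of_ae_hasDerivAt
      (f' := fun t => (-(K (θ t) *ᵥ P.residual (K (θ t)) (θ t))) i) hab ?_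
    filter_upwards [hd] with t ht hmem
    refine ⟨ht hmem, ?_⟩
    rw [Pi.neg_apply]
    linarith [neg_le_of_abs_le (hle t hmem)]
  · have hd' : ∀ᵐ t, t ∈ Set.Ioo a b → HasDerivAt (fun t => -θ t i)
        ((K (θ t) *ᵥ P.residual (K (θ t)) (θ t)) i) t ∧
        (K (θ t) *ᵥ P.residual (K (θ t)) (θ t)) i ≤ M := by
      filter_upwards [hd] with t ht hmem
      refine ⟨?_, le_of_abs_le (hle t hmem)⟩
      have := (ht hmem).fun_neg
      rwa [Pi.neg_apply, neg_neg] at this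
    have := hac.fun_neg.sub_le_mul_of_ae_hasDerivAt hab hd'
    linarith

/-- Decrease of the objective along a solution. -/
lemma mul_sub_le (h : P.IsSolution K θ) (hf : ContDiff ℝ 1 P.f) (hbd : ∀ i, P.lo i < P.hi i)
    (hKpos : ∀ p ∈ P.feasibleSet, (K p).PosDef) {a b δ : ℝ} (ha : 0 ≤ a) (hab : a ≤ b)
    (hbound : ∀ t ∈ Set.Ioo a b,
      δ ≤ P.residual (K (θ t)) (θ t) ⬝ᵥ (K (θ t) *ᵥ P.residual (K (θ t)) (θ t))) :
    δ * (b - a) ≤ P.f (θ a) - P.f (θ b) := by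
  have hac := h.absolutelyContinuousOnInterval ha hab
  -- The objective is only locally Lipschitz; a ball containing this piece of the curve makes the
  -- composition absolutely continuous.
  obtain ⟨C, hC⟩ := hac.exists_bound
  obtain ⟨L, hL⟩ := hf.contDiffOn.exists_lipschitzOnWith one_ne_zero
    (convex_closedBall (0 : Fin n → ℝ) C) (isCompact_closedBall _ _)
  have hfac : AbsolutelyContinuousOnInterval (fun t => P.f (θ t)) a b :=
    hL.comp_absolutelyContinuousOnInterval hac fun t ht => by simpa using hC t ht
  have := hfac.sub_le_mul_of_ae_hasDerivAt (C := -δ) hab (by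
    filter_upwards [h.ae_hasDerivAt (b := b) ha] with t ht hmem
    refine ⟨((hf.differentiable one_ne_zero) (θ t)).hasFDerivAt.comp_hasDerivAt t (ht hmem), ?_⟩
    have ht0 : 0 ≤ t := ha.trans hmem.1.le
    rw [fderiv_apply_eq_grad_dotProduct, dotProduct_neg,
      ← residual_dotProduct_mulVec hbd (hKpos _ (h.feasible t ht0))]
    exact neg_le_neg (hbound t hmem))
  linarith

lemma objective_antitoneOn (h : P.IsSolution K θ) (hf : ContDiff ℝ 1 P.f)
    (hbd : ∀ i, P.lo i < P.hi i) (hKpos : ∀ p ∈ P.feasibleSet, (K p).PosDef) {a b : ℝ}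
    (ha : 0 ≤ a) (hab : a ≤ b) : P.f (θ b) ≤ P.f (θ a) := by
  have := h.mul_sub_le hf hbd hKpos (δ := 0) ha hab fun t ht => by
    simpa using (hKpos _ (h.feasible t (ha.trans ht.1.le))).posSemidef.dotProduct_mulVec_nonneg
      (P.residual (K (θ t)) (θ t))
  linarith

/-- A solution cannot reach the half-sized ball quickly from outside of the ball. -/
lemma mem_closedBall_of_mem_closedBall_half (h : P.IsSolution K θ) {p : Fin n → ℝ}
    {ρ M η τ : ℝ} (hM : 0 < M)
    (hbound : ∀ q ∈ P.feasibleSet, q ∈ Metric.closedBall p ρ →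
      ‖K q *ᵥ P.residual (K q) q‖ ≤ M)
    (hη : M * η < ρ / 2) (hτ : 0 ≤ τ - η) (hmem : θ τ ∈ Metric.closedBall p (ρ / 2)) {s : ℝ}
    (hs : s ∈ Set.Icc (τ - η) τ) : θ s ∈ Metric.closedBall p ρ := by
  by_contra hout
  have hs0 : 0 ≤ s := hτ.trans hs.1
  -- After the last time `σ` outside the open ball the speed bound holds, so the curve moves less
  -- than `ρ / 2` up to `τ`, and `θ σ` was inside after all.
  set E : Set ℝ := Set.Icc s τ ∩ θ ⁻¹' (Metric.ball p ρ)ᶜ with hE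
  have hcont := h.continuousOn_Icc hs0 hs.2
  have hEc : IsCompact E := isCompact_Icc.of_isClosed_subset
    (hcont.preimage_isClosed_of_isClosed isClosed_Icc Metric.isOpen_ball.isClosed_compl)
    Set.inter_subset_left
  have hEs : s ∈ E := ⟨⟨le_rfl, hs.2⟩, fun hb => hout (Metric.ball_subset_closedBall hb)⟩
  obtain ⟨σ, hσE, hσ⟩ := hEc.exists_isGreatest ⟨s, hEs⟩
  have hσ0 : 0 ≤ σ := hs0.trans hσE.1.1
  have hdist := h.norm_sub_le hσ0 hσE.1.2 hM.le fun t ht => by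
    refine hbound _ (h.feasible t (hσ0.trans ht.1.le)) ?_
    by_contra hb
    exact ht.1.not_ge (hσ ⟨⟨hσE.1.1.trans ht.1.le, ht.2.le⟩,
      fun hb' => hb (Metric.ball_subset_closedBall hb')⟩)
  refine hσE.2 ?_
  have h1 : M * (τ - σ) ≤ M * η := by
    gcongr
    linarith [hs.1, hσE.1.1]
  have h2 : dist (θ σ) (θ τ) ≤ M * (τ - σ) := by rwa [dist_comm, dist_eq_norm]
  have h3 : dist (θ τ) p ≤ ρ / 2 := hmem
  have h4 := dist_triangle (θ σ) (θ τ) p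
  rw [Metric.mem_ball]
  linarith

end IsSolution

end BoxProblem

/-! ### Late visits near a limit point, and convergence -/

namespace BoxProblem

variable {n : ℕ} {P : BoxProblem n} {K : (Fin n → ℝ) → Matrix (Fin n) (Fin n) ℝ}

/-- Near `p`, moving from a point where `-∇f(p)` is in the normal cone decreases the objective at
most slowly. -/
lemma eventually_sub_le_of_negMemNormalCone (hf : ContDiff ℝ 1 P.f) (p : Fin n → ℝ) {η : ℝ}
    (hη : 0 < η) : ∃ ρ : ℝ, 0 < ρ ∧ ∀ x ∈ Metric.closedBall p ρ, ∀ y ∈ Metric.closedBall p ρ,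
      P.NegMemNormalCone x (P.grad p) → y ∈ P.feasibleSet →
        P.f x - P.f y ≤ n * (η * ‖y - x‖) := by
  have hev : ∀ᶠ z in 𝓝 p, ∀ i, (P.grad p i < 0 → P.grad z i < 0) ∧
      (0 < P.grad p i → 0 < P.grad z i) ∧ (P.grad p i = 0 → |P.grad z i| < η) := by
    rw [eventually_all]
    intro i
    have hc : ContinuousAt (fun z => P.grad z i) p :=
      ((continuous_apply i).comp (continuous_grad hf)).continuousAt
    rcases lt_trichotomy (P.grad p i) 0 with h | h | h
    · filter_upwards [hc.eventually_lt_const h] with z hz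
      exact ⟨fun _ => hz, fun h' => absurd h' h.not_gt, fun h' => absurd h' h.ne⟩
    · have : ∀ᶠ z in 𝓝 p, |P.grad z i| < η :=
        hc.abs.eventually_lt_const (by simpa [h] using hη)
      filter_upwards [this] with z hz
      exact ⟨fun h' => absurd h h'.ne, fun h' => absurd h h'.ne', fun _ => hz⟩
    · filter_upwards [hc.eventually_const_lt h] with z hz
      exact ⟨fun h' => absurd h' h.not_gt, fun _ => hz, fun h' => absurd h' h.ne'⟩
  obtain ⟨ρ, hρ, hball⟩ := Metric.nhds_basis_closedBall.eventually_iff.1 hev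
  refine ⟨ρ, hρ, fun x hx y hy hN hyf => ?_⟩
  obtain ⟨z, hz, hmvt⟩ := domain_mvt (f := P.f) (f' := fderiv ℝ P.f)
    (fun z _ => ((hf.differentiable one_ne_zero) z).hasFDerivAt.hasFDerivWithinAt)
    (convex_closedBall p ρ) hx hy
  have hz' := hball ((convex_closedBall p ρ).segment_subset hx hy hz)
  rw [fderiv_apply_eq_grad_dotProduct] at hmvt
  rw [mem_feasibleSet] at hyf
  -- Where `P.grad p i ≠ 0`, the point `x` sits on a bound, the feasible `y` can only move inward,
  -- and the gradient at `z` keeps its sign, so the objective does not drop. The other coordinates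
  -- have gradient smaller than `η`.
  have hterm : ∀ i, -(η * ‖y - x‖) ≤ P.grad z i * (y - x) i := by
    intro i
    have h0 : 0 ≤ η * ‖y - x‖ := by positivity
    rcases lt_trichotomy (P.grad p i) 0 with h | h | h
    · have h1 := (hN i).1 h
      rw [mem_active, g_inl_eq_zero] at h1
      have h2 : y i ≤ x i := EReal.coe_le_coe_iff.1 (h1 ▸ (hyf i).2)
      have h3 : 0 ≤ P.grad z i * (y - x) i :=
        mul_nonneg_of_nonpos_of_nonpos ((hz' i).1 h).le (sub_nonpos.2 h2)
      linarith
    · refine neg_le_of_abs_le ?_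
      rw [abs_mul]
      exact mul_le_mul ((hz' i).2.2 h).le (norm_le_pi_norm (y - x) i) (abs_nonneg _) hη.le
    · have h1 := (hN i).2 h
      rw [mem_active, g_inr_eq_zero] at h1
      have h2 : x i ≤ y i := EReal.coe_le_coe_iff.1 (h1 ▸ (hyf i).1)
      have h3 : 0 ≤ P.grad z i * (y - x) i := mul_nonneg ((hz' i).2.1 h).le (sub_nonneg.2 h2)
      linarith
  have hsum : ∑ _i : Fin n, -(η * ‖y - x‖) ≤ P.grad z ⬝ᵥ (y - x) :=
    Finset.sum_le_sum fun i _ => hterm i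
  simp only [Finset.sum_const, Finset.card_univ, Fintype.card_fin, nsmul_eq_mul] at hsum
  linarith

namespace IsSolution

variable {θ : ℝ → Fin n → ℝ}

/-- If the objective converges along a solution, then at all late times at which the solution is
near `p` it lies on the face of the box with `-∇f(p)` in the normal cone. -/
lemma exists_forall_negMemNormalCone (h : P.IsSolution K θ) (hf : ContDiff ℝ 1 P.f)
    (hbd : ∀ i, P.lo i < P.hi i) (hKcont : ContinuousOn K P.feasibleSet)
    (hKpos : ∀ p ∈ P.feasibleSet, (K p).PosDef) {p : Fin n → ℝ} (hp : p ∈ P.feasibleSet)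
    (hlim : ∀ ε > 0, ∃ T, 0 ≤ T ∧ ∀ a b, T ≤ a → a ≤ b → P.f (θ a) - P.f (θ b) < ε) :
    ∃ T ρ : ℝ, 0 ≤ T ∧ 0 < ρ ∧ ∀ τ, T ≤ τ → θ τ ∈ Metric.closedBall p ρ →
      P.NegMemNormalCone (θ τ) (P.grad p) := by
  obtain ⟨M, δ, hM, hδ, hev⟩ := exists_local_bounds hf hbd hKcont hKpos hp
  obtain ⟨ρ₁, hρ₁, hb₁⟩ := Metric.nhds_basis_closedBall.eventually_iff.1
    (eventually_nhdsWithin_iff.1 hev)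
  -- This `η` makes `n * η * M = δ * n / (n + 1) < δ`: leaving the face at full speed cannot achieve
  -- the drop rate `δ`.
  obtain ⟨ρ₂, hρ₂, hb₂⟩ := eventually_sub_le_of_negMemNormalCone hf p
    (η := δ / ((n + 1) * M)) (by positivity)
  set ρ := min ρ₁ ρ₂ with hρ
  have hρ0 : 0 < ρ := lt_min hρ₁ hρ₂
  have hbnd : ∀ q ∈ P.feasibleSet, q ∈ Metric.closedBall p ρ → ‖K q *ᵥ P.residual (K q) q‖ ≤ M :=
    fun q hq hqb => (hb₁ (Metric.closedBall_subset_closedBall (min_le_left _ _) hqb) hq).1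
  have hrate : ∀ q ∈ P.feasibleSet, q ∈ Metric.closedBall p ρ → ¬P.NegMemNormalCone q (P.grad p) →
      δ ≤ P.residual (K q) q ⬝ᵥ (K q *ᵥ P.residual (K q) q) :=
    fun q hq hqb => (hb₁ (Metric.closedBall_subset_closedBall (min_le_left _ _) hqb) hq).2
  set s : ℝ := ρ / (4 * M) with hs
  have hs0 : 0 < s := by positivity
  have hMs : M * s < ρ / 2 := by
    have : M * s = ρ / 4 := by rw [hs]; field_simp
    linarith
  obtain ⟨T, hT0, hT⟩ := hlim (δ * s) (by positivity)
  refine ⟨T + s, ρ / 2, by linarith, by linarith, fun τ hτ hmem => ?_⟩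
  have hτs : 0 ≤ τ - s := by linarith
  have hin : ∀ t ∈ Set.Icc (τ - s) τ, θ t ∈ Metric.closedBall p ρ := fun t ht =>
    h.mem_closedBall_of_mem_closedBall_half hM hbnd hMs hτs hmem ht
  by_contra hoff
  -- The times on the face within the window. If there are none, the drop `δ * s` is too large for a
  -- late time; otherwise compactness yields a last one, after which the rate `δ` applies.
  set E : Set ℝ := Set.Icc (τ - s) τ ∩ θ ⁻¹' {q | P.NegMemNormalCone q (P.grad p)} with hE
  have hEc : IsCompact E := isCompact_Icc.of_isClosed_subset
    ((h.continuousOn_Icc hτs (by linarith)).preimage_isClosed_of_isClosed isClosed_Icc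
      (isClosed_setOf_negMemNormalCone P _)) Set.inter_subset_left
  rcases E.eq_empty_or_nonempty with hempty | hne
  · have hdrop := h.mul_sub_le hf hbd hKpos (δ := δ) hτs (b := τ) (by linarith) fun t ht =>
      hrate _ (h.feasible t (hτs.trans ht.1.le)) (hin t ⟨ht.1.le, ht.2.le⟩) fun hN => by
        have : t ∈ E := ⟨⟨ht.1.le, ht.2.le⟩, hN⟩
        simp [hempty] at this
    have := hT (τ - s) τ (by linarith) (by linarith)
    rw [sub_sub_cancel] at hdrop
    linarith
  · obtain ⟨a, haE, ha⟩ := hEc.exists_isGreatest hne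
    have haτ : a < τ := lt_of_le_of_ne haE.1.2 fun h' => hoff (h' ▸ haE.2)
    have ha0 : 0 ≤ a := hτs.trans haE.1.1
    have hI : ∀ t ∈ Set.Ioo a τ, t ∈ Set.Icc (τ - s) τ := fun t ht =>
      ⟨haE.1.1.trans ht.1.le, ht.2.le⟩
    have hdrop := h.mul_sub_le hf hbd hKpos (δ := δ) ha0 haτ.le fun t ht =>
      hrate _ (h.feasible t (ha0.trans ht.1.le)) (hin t (hI t ht)) fun hN =>
        ht.1.not_ge (ha ⟨hI t ht, hN⟩)
    have hspeed := h.norm_sub_le ha0 haτ.le hM.le fun t ht =>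
      hbnd _ (h.feasible t (ha0.trans ht.1.le)) (hin t (hI t ht))
    have hsub := Metric.closedBall_subset_closedBall (x := p) (min_le_right ρ₁ ρ₂)
    have hslow := hb₂ (θ a) (hsub (hin a haE.1)) (θ τ)
      (hsub (hin τ ⟨by linarith, le_rfl⟩)) haE.2 (h.feasible τ (ha0.trans haτ.le))
    have h1 : n * (δ / ((n + 1) * M) * ‖θ τ - θ a‖) ≤
        n * (δ / ((n + 1) * M) * (M * (τ - a))) := by gcongr
    have h2 : n * (δ / ((n + 1) * M) * (M * (τ - a))) = δ * (τ - a) * (n / (n + 1)) := by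
      field_simp
    have h3 : (n : ℝ) / (n + 1) < 1 := by rw [div_lt_one (by positivity)]; linarith
    have h4 : 0 < δ * (τ - a) := mul_pos hδ (sub_pos.2 haτ)
    nlinarith

/-- The objective is nonincreasing along the whole solution and converges along a sequence of times,
so `P.f p` bounds it below and is its limit. -/
lemma exists_forall_objective_sub_lt (h : P.IsSolution K θ) (hf : ContDiff ℝ 1 P.f)
    (hbd : ∀ i, P.lo i < P.hi i) (hKpos : ∀ p ∈ P.feasibleSet, (K p).PosDef) {p : Fin n → ℝ}
    {t : ℕ → ℝ} (ht : Tendsto t atTop atTop) (hp : Tendsto (fun k => θ (t k)) atTop (𝓝 p)) :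
    ∀ ε > 0, ∃ T, 0 ≤ T ∧ ∀ a b, T ≤ a → a ≤ b → P.f (θ a) - P.f (θ b) < ε := by
  intro ε hε
  have hlim : Tendsto (fun k => P.f (θ (t k))) atTop (𝓝 (P.f p)) :=
    (hf.continuous.tendsto p).comp hp
  have hge : ∀ b, 0 ≤ b → P.f p ≤ P.f (θ b) := fun b hb => by
    refine le_of_tendsto hlim ?_
    filter_upwards [ht.eventually_ge_atTop b] with k hk
    exact h.objective_antitoneOn hf hbd hKpos hb hk
  obtain ⟨k, hk, hk0⟩ := ((hlim.eventually_lt_const (lt_add_of_pos_right _ hε)).and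
    (ht.eventually_ge_atTop 0)).exists
  refine ⟨t k, hk0, fun a b ha hab => ?_⟩
  have h1 := h.objective_antitoneOn hf hbd hKpos hk0 ha
  have h2 := hge b (hk0.trans (ha.trans hab))
  linarith

/-- Limit points of a solution satisfy the KKT conditions, and the residual vanishes in the
limit. -/
lemma negMemNormalCone_and_tendsto_residual (h : P.IsSolution K θ) (hf : ContDiff ℝ 1 P.f)
    (hbd : ∀ i, P.lo i < P.hi i) (hKcont : ContinuousOn K P.feasibleSet)
    (hKpos : ∀ p ∈ P.feasibleSet, (K p).PosDef) {p : Fin n → ℝ} {t : ℕ → ℝ}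
    (ht : Tendsto t atTop atTop) (hp : Tendsto (fun k => θ (t k)) atTop (𝓝 p)) :
    p ∈ P.feasibleSet ∧ P.NegMemNormalCone p (P.grad p) ∧
      Tendsto (fun k => P.residual (K (θ (t k))) (θ (t k))) atTop (𝓝 0) := by
  have hfeas : ∀ᶠ k in atTop, θ (t k) ∈ P.feasibleSet := by
    filter_upwards [ht.eventually_ge_atTop 0] with k hk using h.feasible _ hk
  have hpf : p ∈ P.feasibleSet := (isClosed_feasibleSet P).mem_of_tendsto hp hfeas
  obtain ⟨T, ρ, -, hρ, hcone⟩ := h.exists_forall_negMemNormalCone hf hbd hKcont hKpos hpf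
    (h.exists_forall_objective_sub_lt hf hbd hKpos ht hp)
  have hev : ∀ᶠ k in atTop, P.NegMemNormalCone (θ (t k)) (P.grad p) := by
    filter_upwards [ht.eventually_ge_atTop T, hp (Metric.closedBall_mem_nhds p hρ)] with k hk hk'
    exact hcone _ hk hk'
  refine ⟨hpf, ?_, ?_⟩
  · obtain ⟨k, hk, hk'⟩ := (hev.and (hp.eventually (eventually_active_subset P p))).exists
    exact hk.of_active_subset hk'
  · obtain ⟨m, Λ, hm, hΛ0, hmΛ⟩ := (hKcont p hpf).eventually_posDef_bounds (hKpos p hpf)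
    have hwithin : Tendsto (fun k => θ (t k)) atTop (𝓝[P.feasibleSet] p) :=
      tendsto_nhdsWithin_iff.2 ⟨hp, hfeas⟩
    have hbound : Tendsto (fun k => n * Λ * ‖P.grad (θ (t k)) - P.grad p‖ / m) atTop (𝓝 0) := by
      have h1 : Tendsto (fun k => P.grad (θ (t k)) - P.grad p) atTop (𝓝 0) := by
        simpa using (((continuous_grad hf).tendsto p).comp hp).sub_const (P.grad p)
      simpa using (h1.norm.const_mul (n * Λ)).div_const m
    refine squeeze_zero_norm' ?_ hbound
    filter_upwards [hev, hwithin.eventually hmΛ, hfeas] with k hk hk' hk''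
    rw [le_div_iff₀' hm]
    exact mul_norm_residual_le hbd (hKpos _ hk'') hk'.1 hΛ0 hk'.2 hk

end IsSolution

end BoxProblem

theorem theorem1 {n : ℕ} (P : BoxProblem n) (hf : ContDiff ℝ 1 P.f)
    (hbd : ∀ i, P.lo i < P.hi i)
    (K : (Fin n → ℝ) → Matrix (Fin n) (Fin n) ℝ)
    (hKcont : ContinuousOn K P.feasibleSet) (hKpos : ∀ p ∈ P.feasibleSet, (K p).PosDef)
    (θ : ℝ → Fin n → ℝ) (hθ : P.IsSolution K θ) :
    -- along the trajectory the multiplier formula is meaningful and the multipliers are nonnegative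
    (∀ τ, 0 ≤ τ →
      IsUnit (BoxProblem.hJac (P.qpActive (K (θ τ)) (θ τ)) * K (θ τ) *
        (BoxProblem.hJac (P.qpActive (K (θ τ)) (θ τ)))ᵀ).det ∧
      ∀ j, 0 ≤ P.multiplier (K (θ τ)) (θ τ) j) ∧
    -- whatever the trajectory approaches as `τ → ∞` satisfies the KKT conditions, and the
    -- multipliers converge to the KKT multipliers there, which any gain matrix yields
    (∀ (p : Fin n → ℝ) (t : ℕ → ℝ), Tendsto t atTop atTop →
      Tendsto (fun k => θ (t k)) atTop (𝓝 p) →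
      p ∈ P.kktSet ∧
      ∀ K' : Matrix (Fin n) (Fin n) ℝ, K'.PosDef →
        Tendsto (fun k => P.multiplier (K (θ (t k))) (θ (t k))) atTop
          (𝓝 (P.multiplier K' p))) ∧
    -- a trajectory that cannot or does not escape to infinity satisfies the KKT conditions
    -- asymptotically
    (Bornology.IsBounded {p ∈ P.feasibleSet | P.f p ≤ P.f (θ 0)} ∨
        Bornology.IsBounded (θ '' Set.Ici 0) →
      Tendsto (fun τ => P.residual (K (θ τ)) (θ τ)) atTop (𝓝 0) ∧
      P.kktSet.Nonempty ∧ Tendsto (fun τ => Metric.infDist (θ τ) P.kktSet) atTop (𝓝 0)) ∧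
    -- at every optimal solution and every KKT point the optimal active set of the quadratic
    -- program is the active set, and the multipliers are KKT multipliers independent of the gain
    (∀ p ∈ P.feasibleSet, IsMinOn P.f P.feasibleSet p ∨ p ∈ P.kktSet →
      ∀ K' : Matrix (Fin n) (Fin n) ℝ, K'.PosDef →
        P.qpActive K' p = P.active p ∧
        P.IsKKTMultiplier p (P.multiplier K' p) ∧
        ∀ K'' : Matrix (Fin n) (Fin n) ℝ, K''.PosDef →
          P.multiplier K' p = P.multiplier K'' p) := by
  have hlimit := fun (p : Fin n → ℝ) (t : ℕ → ℝ) (ht : Tendsto t atTop atTop)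
    (hp : Tendsto (fun k => θ (t k)) atTop (𝓝 p)) =>
    hθ.negMemNormalCone_and_tendsto_residual hf hbd hKcont hKpos ht hp
  refine ⟨fun τ hτ => ?_, fun p t ht hp => ?_, fun hbounded => ?_, fun p hp hopt K' hK' => ?_⟩
  · have hK := hKpos _ (hθ.feasible τ hτ)
    refine ⟨?_, BoxProblem.multiplier_nonneg hbd hK⟩
    exact (Matrix.isUnit_iff_isUnit_det _).1 (BoxProblem.posDef_hJac_mul_mul_transpose hbd hK
      BoxProblem.qpActive_subset_active).isUnit
  · obtain ⟨hpf, hN, hr⟩ := hlimit p t ht hp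
    refine ⟨hN.mem_kktSet hbd hpf, fun K' hK' => ?_⟩
    rw [hN.multiplier_eq hbd hK']
    -- The multipliers are a continuous function of residual minus gradient, so the discontinuity of
    -- the active set does no harm; the limit involves only `-P.grad p`, hence no gain.
    have hdiff := hr.sub (((BoxProblem.continuous_grad hf).tendsto p).comp hp)
    rw [zero_sub] at hdiff
    refine ((BoxProblem.continuous_signedParts.tendsto _).comp hdiff).congr' ?_
    filter_upwards [ht.eventually_ge_atTop 0] with k hk
    exact (BoxProblem.multiplier_eq_signedParts_residual hbd (hKpos _ (hθ.feasible _ hk))).symm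
  · have hbdd : Bornology.IsBounded (θ '' Set.Ici 0) := by
      refine hbounded.elim (fun hb => hb.subset ?_) id
      rintro _ ⟨τ, hτ, rfl⟩
      exact ⟨hθ.feasible τ hτ, hθ.objective_antitoneOn hf hbd hKpos le_rfl hτ⟩
    have hsubseq : ∀ t : ℕ → ℝ, Tendsto t atTop atTop → ∃ (p : Fin n → ℝ) (φ : ℕ → ℕ),
        Tendsto (fun k => t (φ k)) atTop atTop ∧
          Tendsto (fun k => θ (t (φ k))) atTop (𝓝 p) := by
      intro t ht
      obtain ⟨p, -, φ, hφ, hlim⟩ := tendsto_subseq_of_frequently_bounded hbdd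
        (x := fun k => θ (t k)) (Eventually.frequently (by
          filter_upwards [ht.eventually_ge_atTop 0] with k hk using ⟨t k, hk, rfl⟩))
      exact ⟨p, φ, ht.comp hφ.tendsto_atTop, hlim⟩
    refine ⟨?_, ?_, ?_⟩
    · refine tendsto_of_subseq_tendsto fun t ht => ?_
      obtain ⟨p, φ, hφ, hlim⟩ := hsubseq t ht
      exact ⟨φ, (hlimit p _ hφ hlim).2.2⟩
    · obtain ⟨p, φ, hφ, hlim⟩ := hsubseq (fun k => (k : ℝ)) tendsto_natCast_atTop_atTop
      obtain ⟨hpf, hN, -⟩ := hlimit p _ hφ hlim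
      exact ⟨p, hN.mem_kktSet hbd hpf⟩
    · refine tendsto_of_subseq_tendsto fun t ht => ?_
      obtain ⟨p, φ, hφ, hlim⟩ := hsubseq t ht
      obtain ⟨hpf, hN, -⟩ := hlimit p _ hφ hlim
      refine ⟨φ, ?_⟩
      have := ((Metric.continuous_infDist_pt P.kktSet).tendsto p).comp hlim
      rwa [Metric.infDist_zero_of_mem (hN.mem_kktSet hbd hpf)] at this
  · have hN : P.NegMemNormalCone p (P.grad p) := by
      rcases hopt with hmin | ⟨-, π, hπ⟩
      · exact BoxProblem.negMemNormalCone_of_isMinOn hf hp hmin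
      · exact hπ.negMemNormalCone
    refine ⟨hN.qpActive_eq hbd hK', hN.isKKTMultiplier hbd hK', fun K'' hK'' => ?_⟩
    rw [hN.multiplier_eq hbd hK', hN.multiplier_eq hbd hK'']
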